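/- **Notation.** Let $U\subset\mathbb R^n$ be open and bounded. $ba(U,\mathcal B,\mathcal L^n)$ is the set of bounded, finitely additive $\lambda:\mathcal B(U)\to\mathbb R$ on the Borel sets of $U$ with $\lambda(A)=0$ whenever $\mathcal L^n(A)=0$. For $\mu\in ba(U,\mathcal B,\mathcal L^n)^m$ the total variation $|\mu|(A)$ is the supremum of $\sum_j|\mu(A_j)|$ over finite Borel partitions of $A$. The core of $\mu$ is the set of all $x\in\mathbb R^n$ with $|\mu|(O\cap U)>0$ for every open $O\ni x$. Integrals with respect to finitely additive measures are defined by determining sequences: $\int_U f\,d\lambda=\lim_k\int_U s_k\,d\lambda$, where the $s_k$ are simple functions that converge to $f$ in measure and satisfy $\int_U|s_k-s_l|\,d|\lambda|\to0$ as $k,l\to\infty$; for vector fields and vector measures $\int G\,d\mu=\sum_j\int G_j\,d\mu_j$; and $\int_A f\,d\lambda=\int_U\chi_Af\,d\lambda$. If the core of $\lambda$ lies in a closed set $K$, then $\oint_K f\,d\lambda$ denotes the common value of $\int_{O\cap U}f\,d\lambda$ for all open $O\supset K$. $\mathcal{DM}^1(U)$ is the space of all $F\in L^1(U,\mathbb R^n)$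 whose distributional divergence is a finite signed Borel measure $\operatorname{div}F$ on $U$. $W^{1,\infty}(U)$ carries the norm $\max\{\|\varphi\|_\infty,\|D\varphi\|_\infty\}$. $K_\delta$ is the open $\delta$-neighbourhood of $K$. Let $K=\partial\Omega$ (boundary in $\mathbb R^n$) and $V=K_\delta\cap U$. *Case (L)* means: the map $\varphi\mapsto([\varphi],D\varphi)$ from $W^{1,\infty}(V)$ to $L^\infty_K(V)\times L^\infty(V,\mathbb R^n)$ is injective with continuous inverse on its image, where $L^\infty_K(V)=L^\infty(V)/\{\varphi:\|\varphi\|_K=0\}$ with the quotient norm and $\|\varphi\|_K=\lim_{\eta\downarrow0}\|\varphi\|_{L^\infty(K_\eta\cap V)}$. *Case (C)* means: every $\varphi\in W^{1,\infty}(V)$ extends continuously up to $K$, and the map $\varphi\mapsto(\varphi|_K,D\varphi)$ from $W^{1,\infty}(V)$ to $C(K)\times L^\infty(V,\mathbb R^n)$ is injective with continuous inverse on its image. **Theorem.** Let $U\subset\mathbb R^n$ be open and bounded, let $\Omega\subset U$ be a Borel set, let $\delta>0$ and let $F\in\mathcal{DM}^1(U)$. Then there are $\lambda_F\in ba(U,\mathcal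 B,\mathcal L^n)$ and $\mu_F\in ba(U,\mathcal B,\mathcal L^n)^n$, both with core contained in $\overline{(\partial\Omega)_\delta\cap U}$, such that for all $\varphi\in W^{1,\infty}(U)$ one has $\varphi F\in\mathcal{DM}^1(U)$, the integrals below exist, and $$\operatorname{div}(\varphi F)(\Omega)=\int_{(\partial\Omega)_\delta\cap U}\varphi\,d\lambda_F+\int_{(\partial\Omega)_\delta\cap U}D\varphi\,d\mu_F .$$ Moreover, $\lambda_F$ and $\mu_F$ can be chosen such that, in addition, the following holds. In case (L) (for $K=\partial\Omega$ and $\delta$), the core of $\lambda_F$ is contained in $\partial\Omega$, and for all $\varphi\in W^{1,\infty}(U)$ $$\operatorname{div}(\varphi F)(\Omega)=\oint_{\partial\Omega}\varphi\,d\lambda_F+\int_{(\partial\Omega)_\delta\cap U}D\varphi\,d\mu_F .$$ In case (C) (for $K=\partial\Omega$ and $\delta$), the core of $\lambda_F$ is contained in $\partial\Omega$ and $\lambda_F$ corresponds to a finite signed Radon measure $\sigma_F$ with $\operatorname{supp}\sigma_F\subset\partial\Omega$, in the sense that $\int_U\psi\,d\lambda_F=\int_{\partial\Omega}\psi\,d\sigma_F$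 for all $\psi\in C(\overline U)$, and for all $\varphi\in W^{1,\infty}(U)$ $$\operatorname{div}(\varphi F)(\Omega)=\int_{\partial\Omega}\varphi\,d\sigma_F+\int_{(\partial\Omega)_\delta\cap U}D\varphi\,d\mu_F ,$$ where $\varphi$ on $\partial\Omega$ is the continuous extension of $\varphi|_{(\partial\Omega)_\delta\cap U}$. -/

import Mathlib

open MeasureTheory Set Filter Topology
open scoped ENNReal ContDiff

noncomputable section

/-- The Euclidean space `ℝⁿ`. -/
abbrev Euc (n : ℕ) := EuclideanSpace ℝ (Fin n)

/-! ### Finitely additive measures and their integral -/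

section FinitelyAdditive

variable {α : Type*} [MeasurableSpace α]

/-- Real-valued, finitely additive set functions on the measurable sets of `α`. Values on
non-measurable sets are irrelevant and never used. -/
abbrev FinAddMeasure (α : Type*) [MeasurableSpace α] := AddContent ℝ {A : Set α | MeasurableSet A}

/-- Total variation of a (vector-valued) set function: the supremum of `∑ |m (A_j)|` over all finite
partitions of `A` into measurable sets. -/
def totalVar {V : Type*} [NormedAddCommGroup V] (m : Set α → V) (A : Set α) : ℝ≥0∞ :=
  ⨆ (P : Finset (Set α)) (_ : (∀ B ∈ P, MeasurableSet B) ∧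
    (P : Set (Set α)).PairwiseDisjoint id ∧ ⋃₀ (P : Set (Set α)) = A), ∑ B ∈ P, ‖m B‖ₑ

/-- The outer measure `|m|^*(S) = inf {|m|(B) : S ⊆ B, B measurable}`. -/
def outerVar (m : Set α → ℝ) (S : Set α) : ℝ≥0∞ :=
  ⨅ (B : Set α) (_ : MeasurableSet B ∧ S ⊆ B), totalVar m B

/-- Convergence in measure with respect to a finitely additive measure. -/
def TendstoInVar (m : Set α → ℝ) (s : ℕ → α → ℝ) (f : α → ℝ) : Prop :=
  ∀ ε : ℝ, 0 < ε → Tendsto (fun k => outerVar m {x | ε < |s k x - f x|}) atTop (𝓝 0)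

/-- `∫ s dm` for a simple function `s` (finitely many values, measurable fibres). -/
def simpleIntegral (m : Set α → ℝ) (s : SimpleFunc α ℝ) : ℝ :=
  ∑ y ∈ s.range, y * m (s ⁻¹' {y})

/-- `∫ |s| d|m|` for a simple function `s`. -/
def simpleAbsIntegral (m : Set α → ℝ) (s : SimpleFunc α ℝ) : ℝ≥0∞ :=
  ∑ y ∈ s.range, ‖y‖ₑ * totalVar m (s ⁻¹' {y})

/-- `f` is integrable with respect to the (bounded) finitely additive measure `m`, with integral
`I`: there is a determining sequence of simple functions, i.e. a sequence converging to `f` in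
measure that is Cauchy for `∫ |·| d|m|`, whose integrals converge to `I`. -/
def HasIntegral (m : FinAddMeasure α) (f : α → ℝ) (I : ℝ) : Prop :=
  ∃ s : ℕ → SimpleFunc α ℝ,
    TendstoInVar m (fun k => s k) f ∧
    Tendsto (fun p : ℕ × ℕ => simpleAbsIntegral m (s p.1 - s p.2)) atTop (𝓝 0) ∧
    Tendsto (fun k => simpleIntegral m (s k)) atTop (𝓝 I)

/-- `∫_A f dm = I`, with `∫_A f dm = ∫ χ_A f dm`. -/
def HasIntegralOn (m : FinAddMeasure α) (A : Set α) (f : α → ℝ) (I : ℝ) : Prop :=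
  HasIntegral m (A.indicator f) I

end FinitelyAdditive

/-- `∫_A G dm = ∑ⱼ ∫_A Gⱼ dmⱼ = I` for a vector field `G` and a vector measure `m = (m₁, …, mₙ)`. -/
def HasVecIntegralOn {n : ℕ} (m : Fin n → FinAddMeasure (Euc n)) (A : Set (Euc n))
    (G : Euc n → Euc n) (I : ℝ) : Prop :=
  ∃ c : Fin n → ℝ, (∀ j, HasIntegralOn (m j) A (fun x => G x j) (c j)) ∧ I = ∑ j, c j

/-- The `ℝⁿ`-valued set function of a vector measure `m = (m₁, …, mₙ)`. -/
def vecSet {n : ℕ} (m : Fin n → FinAddMeasure (Euc n)) (A : Set (Euc n)) : Euc n :=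
  WithLp.toLp 2 fun j => m j A

/-- `m ∈ ba(U, 𝓑(U), 𝓛ⁿ)`: `m` is bounded and vanishes on Lebesgue null sets. For open `U`, a measure
on the Borel subsets of `U` is identified with its extension by zero to the Borel subsets of `ℝⁿ`;
both `m ≪ 𝓛ⁿ` (weakly) and `m = 0` outside `U` are expressed by `m A = 0` whenever
`𝓛ⁿ(A ∩ U) = 0`. -/
def IsBA {n : ℕ} (U : Set (Euc n)) (m : FinAddMeasure (Euc n)) : Prop :=
  (∃ C : ℝ, ∀ A, MeasurableSet A → |m A| ≤ C) ∧
    ∀ A, MeasurableSet A → volume (A ∩ U) = 0 → m A = 0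

/-- The core of a measure on a bounded set `U ⊆ ℝⁿ`: all `x` such that every open neighbourhood `O`
of `x` satisfies `|m|(O ∩ U) > 0`. -/
def core {n : ℕ} {V : Type*} [NormedAddCommGroup V] (U : Set (Euc n)) (m : Set (Euc n) → V) :
    Set (Euc n) :=
  {x | ∀ O : Set (Euc n), IsOpen O → x ∈ O → 0 < totalVar m (O ∩ U)}

/-! ### Divergence measure fields -/

/-- `ψ ∈ C_c^∞(V)`. -/
def IsTest {n : ℕ} (V : Set (Euc n)) (ψ : Euc n → ℝ) : Prop :=
  ContDiff ℝ ∞ ψ ∧ HasCompactSupport ψ ∧ tsupport ψ ⊆ V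

/-- The finite signed Borel measure `ν`, concentrated on `U`, is the distributional divergence of
`F` on `U`: `∫_U F · Dψ dx = - ∫ ψ dν` for all test functions `ψ`. -/
def IsDivMeasure {n : ℕ} (U : Set (Euc n)) (F : Euc n → Euc n) (ν : SignedMeasure (Euc n)) : Prop :=
  (∀ A, MeasurableSet A → A ⊆ Uᶜ → ν A = 0) ∧
    ∀ ψ : Euc n → ℝ, IsTest U ψ → ∫ x in U, fderiv ℝ ψ x (F x) = - ∫ᵛ x, ψ x ∂•ν

/-- `F ∈ 𝓓𝓜¹(U)`: `F` is integrable on `U` and its distributional divergence is a finite signed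
measure. -/
def MemDM1 {n : ℕ} (U : Set (Euc n)) (F : Euc n → Euc n) : Prop :=
  IntegrableOn F U volume ∧ ∃ ν : SignedMeasure (Euc n), IsDivMeasure U F ν

open Classical in
/-- The measure `div F` of a field `F ∈ 𝓓𝓜¹(U)` (and `0` for other fields). -/
def divMeasure {n : ℕ} (U : Set (Euc n)) (F : Euc n → Euc n) : SignedMeasure (Euc n) :=
  if h : ∃ ν : SignedMeasure (Euc n), IsDivMeasure U F ν then h.choose else 0

/-! ### The space `W^{1,∞}` -/

/-- `L^∞(V, G)`. -/
abbrev Linf {n : ℕ} (V : Set (Euc n)) (G : Type*) [NormedAddCommGroup G] :=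
  Lp G ∞ ((volume : Measure (Euc n)).restrict V)

/-- `G` is the weak gradient of `φ` on `V`. -/
def IsWeakGrad {n : ℕ} (V : Set (Euc n)) (φ : Euc n → ℝ) (G : Euc n → Euc n) : Prop :=
  ∀ ψ : Euc n → ℝ, IsTest V ψ → ∀ i : Fin n,
    ∫ x in V, φ x * fderiv ℝ ψ x (EuclideanSpace.single i 1) = - ∫ x in V, G x i * ψ x

lemma integrable_Linf_mul {n : ℕ} {V : Set (Euc n)} (φ : Linf V ℝ) {h : Euc n → ℝ}
    (hc : Continuous h) (hs : HasCompactSupport h) :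
    Integrable (fun x => φ x * h x) (volume.restrict V) := by
  have h1 : Integrable h (volume.restrict V) := (hc.integrable_of_hasCompactSupport hs).restrict
  exact h1.essSup_smul (Lp.aestronglyMeasurable φ) (Lp.eLpNorm_lt_top φ).ne

lemma integrable_Linf_coord_mul {n : ℕ} {V : Set (Euc n)} (G : Linf V (Euc n)) {h : Euc n → ℝ}
    (hc : Continuous h) (hs : HasCompactSupport h) (i : Fin n) :
    Integrable (fun x => G x i * h x) (volume.restrict V) := by
  have h1 : Integrable h (volume.restrict V) := (hc.integrable_of_hasCompactSupport hs).restrict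
  have h2 : Integrable (fun x => h x • G x) (volume.restrict V) :=
    h1.smul_essSup (Lp.aestronglyMeasurable G) (Lp.eLpNorm_lt_top G).ne
  have h3 := (EuclideanSpace.proj i : Euc n →L[ℝ] ℝ).integrable_comp h2
  refine h3.congr (Eventually.of_forall fun x => ?_)
  simp [mul_comm]

/-- `W^{1,∞}(V)`, as the space of pairs `(φ, Dφ) ∈ L^∞(V) × L^∞(V, ℝⁿ)` where `Dφ` is the weak
gradient of `φ`. The norm inherited from the product is `max {‖φ‖_∞, ‖Dφ‖_∞}`. -/
def W1inf {n : ℕ} (V : Set (Euc n)) : Submodule ℝ (Linf V ℝ × Linf V (Euc n)) where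
  carrier := {p | IsWeakGrad V p.1 p.2}
  zero_mem' := by
    intro ψ hψ i
    have h1 : ∀ᵐ x ∂((volume : Measure (Euc n)).restrict V),
        (0 : Linf V ℝ) x * fderiv ℝ ψ x (EuclideanSpace.single i 1) = 0 := by
      filter_upwards [Lp.coeFn_zero ℝ ∞ ((volume : Measure (Euc n)).restrict V)] with x hx
      rw [hx, Pi.zero_apply, zero_mul]
    have h2 : ∀ᵐ x ∂((volume : Measure (Euc n)).restrict V),
        (0 : Linf V (Euc n)) x i * ψ x = 0 := by
      filter_upwards [Lp.coeFn_zero (Euc n) ∞ ((volume : Measure (Euc n)).restrict V)] with x hx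
      rw [hx, Pi.zero_apply, PiLp.zero_apply, zero_mul]
    simp only [Prod.fst_zero, Prod.snd_zero]
    rw [integral_congr_ae h1, integral_congr_ae h2]
    simp
  add_mem' := by
    intro p q hp hq ψ hψ i
    have hd : Continuous fun x => fderiv ℝ ψ x (EuclideanSpace.single i 1) :=
      (hψ.1.continuous_fderiv (by simp)).clm_apply continuous_const
    have hds : HasCompactSupport fun x => fderiv ℝ ψ x (EuclideanSpace.single i 1) :=
      hψ.2.1.fderiv_apply (𝕜 := ℝ) _
    have h1 : ∀ᵐ x ∂((volume : Measure (Euc n)).restrict V),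
        (p + q).1 x * fderiv ℝ ψ x (EuclideanSpace.single i 1) =
          p.1 x * fderiv ℝ ψ x (EuclideanSpace.single i 1) +
          q.1 x * fderiv ℝ ψ x (EuclideanSpace.single i 1) := by
      filter_upwards [Lp.coeFn_add p.1 q.1] with x hx
      rw [Prod.fst_add, hx, Pi.add_apply, add_mul]
    have h2 : ∀ᵐ x ∂((volume : Measure (Euc n)).restrict V),
        (p + q).2 x i * ψ x = p.2 x i * ψ x + q.2 x i * ψ x := by
      filter_upwards [Lp.coeFn_add p.2 q.2] with x hx
      rw [Prod.snd_add, hx, Pi.add_apply, PiLp.add_apply, add_mul]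
    rw [integral_congr_ae h1, integral_congr_ae h2,
      integral_add (integrable_Linf_mul p.1 hd hds) (integrable_Linf_mul q.1 hd hds),
      integral_add (integrable_Linf_coord_mul p.2 hψ.1.continuous hψ.2.1 i)
        (integrable_Linf_coord_mul q.2 hψ.1.continuous hψ.2.1 i), hp ψ hψ i, hq ψ hψ i]
    ring
  smul_mem' := by
    intro c p hp ψ hψ i
    have h1 : ∀ᵐ x ∂((volume : Measure (Euc n)).restrict V),
        (c • p).1 x * fderiv ℝ ψ x (EuclideanSpace.single i 1) =
          c * (p.1 x * fderiv ℝ ψ x (EuclideanSpace.single i 1)) := by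
      filter_upwards [Lp.coeFn_smul c p.1] with x hx
      rw [Prod.smul_fst, hx, Pi.smul_apply, smul_eq_mul, mul_assoc]
    have h2 : ∀ᵐ x ∂((volume : Measure (Euc n)).restrict V),
        (c • p).2 x i * ψ x = c * (p.2 x i * ψ x) := by
      filter_upwards [Lp.coeFn_smul c p.2] with x hx
      rw [Prod.smul_snd, hx, Pi.smul_apply, PiLp.smul_apply, smul_eq_mul, mul_assoc]
    rw [integral_congr_ae h1, integral_congr_ae h2, integral_const_mul, integral_const_mul,
      hp ψ hψ i]
    ring

/-- The class in `L^∞(V)` of `φ ∈ W^{1,∞}(V)`. -/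
def funLinf {n : ℕ} (V : Set (Euc n)) : W1inf V →ₗ[ℝ] Linf V ℝ :=
  (LinearMap.fst ℝ (Linf V ℝ) (Linf V (Euc n))).comp (W1inf V).subtype

/-- The weak gradient `W^{1,∞}(V) → L^∞(V, ℝⁿ)`. -/
def gradLinf {n : ℕ} (V : Set (Euc n)) : W1inf V →ₗ[ℝ] Linf V (Euc n) :=
  (LinearMap.snd ℝ (Linf V ℝ) (Linf V (Euc n))).comp (W1inf V).subtype

/-- A representative of `φ ∈ W^{1,∞}(V)`. -/
def funRep {n : ℕ} {V : Set (Euc n)} (φ : W1inf V) : Euc n → ℝ := funLinf V φ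

/-- A representative of the weak gradient `Dφ` of `φ ∈ W^{1,∞}(V)`. -/
def gradRep {n : ℕ} {V : Set (Euc n)} (φ : W1inf V) : Euc n → Euc n := gradLinf V φ

/-! ### The cases (L) and (C) -/

/-- The subspace of all `φ ∈ L^∞(V)` with `‖φ‖_K = lim_{η ↓ 0} ‖φ‖_{L^∞(K_η ∩ V)} = 0`, where `K_η` is
the open `η`-neighbourhood of `K`. -/
def nullNear {n : ℕ} (K V : Set (Euc n)) : Submodule ℝ (Linf V ℝ) where
  carrier := {φ | Tendsto (fun η : ℝ =>
    eLpNorm φ ∞ (volume.restrict (Metric.thickening η K ∩ V))) (𝓝[>] 0) (𝓝 0)}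
  zero_mem' := by
    refine tendsto_const_nhds.congr fun η => ?_
    have h : ((0 : Linf V ℝ) : Euc n → ℝ) =ᵐ[volume.restrict (Metric.thickening η K ∩ V)] 0 :=
      ae_mono (Measure.restrict_mono_set _ inter_subset_right)
        (Lp.coeFn_zero ℝ ∞ ((volume : Measure (Euc n)).restrict V))
    rw [eLpNorm_congr_ae h, eLpNorm_zero]
  add_mem' := by
    intro φ χ hφ hχ
    refine tendsto_of_tendsto_of_tendsto_of_le_of_le tendsto_const_nhds
      (by simpa using Tendsto.add hφ hχ) (fun _ => bot_le) fun η => ?_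
    have hle : (volume : Measure (Euc n)).restrict (Metric.thickening η K ∩ V) ≤
        volume.restrict V := Measure.restrict_mono_set _ inter_subset_right
    rw [eLpNorm_congr_ae (ae_mono hle (Lp.coeFn_add φ χ))]
    exact eLpNorm_add_le ((Lp.aestronglyMeasurable φ).mono_measure hle)
      ((Lp.aestronglyMeasurable χ).mono_measure hle) le_top
  smul_mem' := by
    intro c φ hφ
    have h : Tendsto (fun η : ℝ =>
        ‖c‖ₑ * eLpNorm φ ∞ (volume.restrict (Metric.thickening η K ∩ V))) (𝓝[>] 0) (𝓝 0) := by
      simpa using ENNReal.Tendsto.const_mul hφ (Or.inr (enorm_ne_top (x := c)))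
    refine h.congr fun η => ?_
    have hle : (volume : Measure (Euc n)).restrict (Metric.thickening η K ∩ V) ≤
        volume.restrict V := Measure.restrict_mono_set _ inter_subset_right
    rw [eLpNorm_congr_ae (ae_mono hle (Lp.coeFn_smul c φ)), eLpNorm_const_smul]

/-- `L^∞_K(V) = L^∞(V) / {φ : ‖φ‖_K = 0}`, with the quotient norm. -/
abbrev LinfNear {n : ℕ} (K V : Set (Euc n)) := Linf V ℝ ⧸ nullNear K V

/-- For a linear map `ι₀ : W^{1,∞}(V) → X₀`, the map `ι = (ι₀, D)` into `X₀ × L^∞(V, ℝⁿ)` has a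
continuous inverse on its image. -/
def HasContInverse {n : ℕ} {V : Set (Euc n)} {X₀ : Type*} [AddCommGroup X₀] [Module ℝ X₀]
    [TopologicalSpace X₀] (ι₀ : W1inf V →ₗ[ℝ] X₀) : Prop :=
  ∃ g : LinearMap.range (ι₀.prod (gradLinf V)) → W1inf V,
    Continuous g ∧ ∀ φ, g ((ι₀.prod (gradLinf V)).rangeRestrict φ) = φ

/-- `g` is continuous on `V ∪ K` and agrees with `φ` almost everywhere on `V`: the function `φ` is
continuous on `V` (after modification on a null set) and `g` is its continuous extension up to
`K`. -/
def IsContExt {n : ℕ} (V K : Set (Euc n)) (φ g : Euc n → ℝ) : Prop :=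
  ContinuousOn g (V ∪ K) ∧ g =ᵐ[volume.restrict V] φ

/-- Case (L) for `K`, `U` and `δ`: `ι(φ) = (φ + {‖·‖_K = 0}, Dφ)` from `W^{1,∞}(K_δ ∩ U)` to
`L^∞_K(K_δ ∩ U) × L^∞(K_δ ∩ U, ℝⁿ)` has a continuous inverse on its image. -/
def CaseL {n : ℕ} (U K : Set (Euc n)) (δ : ℝ) : Prop :=
  HasContInverse (X₀ := LinfNear K (Metric.thickening δ K ∩ U))
    ((nullNear K (Metric.thickening δ K ∩ U)).mkQ.comp (funLinf (Metric.thickening δ K ∩ U)))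

/-- Case (C) for `K`, `U` and `δ`: all `φ ∈ W^{1,∞}(K_δ ∩ U)` are continuously extendable up to `K`,
and `ι(φ) = (φ|_K, Dφ)` from `W^{1,∞}(K_δ ∩ U)` to `C(K) × L^∞(K_δ ∩ U, ℝⁿ)` has a continuous inverse
on its image. (For compact `K` the topology of `C(K, ℝ)` is that of the maximum norm.) -/
def CaseC {n : ℕ} (U K : Set (Euc n)) (δ : ℝ) : Prop :=
  ∃ ι₀ : W1inf (Metric.thickening δ K ∩ U) →ₗ[ℝ] C(K, ℝ),
    (∀ φ, ∃ g : Euc n → ℝ, IsContExt (Metric.thickening δ K ∩ U) K (funRep φ) g ∧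
      ∀ x : K, ι₀ φ x = g x) ∧
    HasContInverse ι₀

end

/-! Write K for the boundary of Ω and V = K_δ ∩ U. The functional T(φ) = div(φF)(Ω) is linear in φ,
and the theorem follows once T is seen to depend continuously on φ and Dφ restricted to V.

The estimate comes from the product rule div(φF) = φ̃ div F + Dφ · F dx, with φ̃ the continuous
representative (`IsSmoothApprox.isDivMeasure`, by mollification). Take a test function η with η =
χ_Ω and Dη = 0 off K_δ, and |χ_Ω − η| ≤ 1 everywhere. Testing div(φF) with η gives T(φ) = ∫ (χ_Ω −
η) d div(φF) − ∫_U φ F · Dη dx, where only points of V contribute. Hence |T(φ)| ≤ C(‖φ‖ + ‖Dφ‖) with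
norms over V (`exists_divMeasure_bound`).

By Hahn–Banach (`exists_functional_of_seminorm_bound`), T(φ) = Λ₁(φ|V) + Λ₂(Dφ|V) with bounded Λ₁ on
L^∞(V) and Λ₂ on L^∞(V, ℝⁿ). The set functions A ↦ Λ₁(1_A) and A ↦ Λ₂(1_A eⱼ) are the required
measures, because a bounded functional on L^∞ is integration against its finitely additive measure
(`hasIntegral_finAddOfFunctional`).

In cases (L) and (C) the norm of φ over V is controlled by its norm in L^∞_K(V) together with ‖Dφ‖.
For (C) this uses that boundary values are bounded by the quotient norm (`CaseC.exists_bound`). The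
extension can then be dominated by the quotient seminorm, so Λ₁ vanishes on `nullNear`. This puts
the core in K, and makes Λ₁(f) depend only on f|_K when f is continuous up to K. The Riesz theorem
on C(K) then supplies σ (`exists_signedMeasure_of_functional`). -/

noncomputable section

/-! ### Total variation, and integration against finitely additive measures -/

section FinitelyAdditiveLemmas

variable {α : Type*} [MeasurableSpace α]

lemma totalVar_add_le {V : Type*} [NormedAddCommGroup V] {m : Set α → V} (hm : m ∅ = 0)
    {A B : Set α} (hA : MeasurableSet A) (hB : MeasurableSet B) (h : Disjoint A B) :
    totalVar m A + totalVar m B ≤ totalVar m (A ∪ B) := by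
  classical
  refine ENNReal.biSup_add_biSup_le' ⟨{A}, by simpa using hA⟩ ⟨{B}, by simpa using hB⟩ ?_
  rintro P ⟨hP1, hP2, hP3⟩ Q ⟨hQ1, hQ2, hQ3⟩
  have hPA : ∀ p ∈ P, p ⊆ A := fun p hp => hP3 ▸ subset_sUnion_of_mem (by simpa using hp)
  have hQB : ∀ p ∈ Q, p ⊆ B := fun p hp => hQ3 ▸ subset_sUnion_of_mem (by simpa using hp)
  -- A set common to both partitions lies in A ∩ B = ∅. So only the empty set can be shared, and it
  -- contributes nothing.
  have hint : ∑ p ∈ P ∩ Q, ‖m p‖ₑ = 0 := by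
    refine Finset.sum_eq_zero fun p hp => ?_
    rw [Finset.mem_inter] at hp
    have : p = ∅ := by
      have := h (hPA p hp.1) (hQB p hp.2)
      simpa using this
    simp [this, hm]
  rw [← Finset.sum_union_inter, hint, add_zero]
  refine le_iSup₂_of_le (P ∪ Q) ⟨?_, ?_, ?_⟩ le_rfl
  · intro p hp
    rcases Finset.mem_union.1 hp with hp | hp
    exacts [hP1 p hp, hQ1 p hp]
  · rw [Finset.coe_union, pairwiseDisjoint_union]
    exact ⟨hP2, hQ2, fun p hp q hq _ => h.mono (hPA p hp) (hQB q hq)⟩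
  · rw [Finset.coe_union, sUnion_union, hP3, hQ3]

lemma sum_totalVar_le {V ι : Type*} [NormedAddCommGroup V] {m : Set α → V} (hm : m ∅ = 0)
    (s : Finset ι) {f : ι → Set α} (hf : ∀ i, MeasurableSet (f i))
    (hd : Pairwise (Function.onFun Disjoint f)) :
    ∑ i ∈ s, totalVar m (f i) ≤ totalVar m (⋃ i ∈ s, f i) := by
  classical
  induction s using Finset.induction_on with
  | empty => simp
  | insert i s hi ih =>
    rw [Finset.sum_insert hi, Finset.set_biUnion_insert]
    refine (add_le_add_right ih _).trans (totalVar_add_le hm (hf i)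
      (Finset.measurableSet_biUnion s fun j _ => hf j) ?_)
    rw [disjoint_iUnion₂_right]
    exact fun j hj => hd (by rintro rfl; exact hi hj)

lemma totalVar_eq_zero {V : Type*} [NormedAddCommGroup V] {m : Set α → V} {A : Set α}
    (h : ∀ B, MeasurableSet B → B ⊆ A → m B = 0) : totalVar m A = 0 := by
  unfold totalVar
  simp only [ENNReal.iSup_eq_zero]
  rintro P ⟨hP1, -, hP3⟩
  refine Finset.sum_eq_zero fun p hp => ?_
  rw [h p (hP1 p hp) (hP3 ▸ subset_sUnion_of_mem (by simpa using hp)), enorm_zero]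

/-- Splitting a partition by the sign of m turns each half of the sum into ± the value of m on one
union, at most C in modulus. Hence the factor 2. -/
lemma totalVar_le_of_abs_le (m : FinAddMeasure α) {C : ℝ} (hC : ∀ A, MeasurableSet A → |m A| ≤ C)
    (A : Set α) : totalVar m A ≤ ENNReal.ofReal (2 * C) := by
  classical
  refine iSup₂_le ?_
  rintro P ⟨hP1, hP2, -⟩
  have key : ∀ Q ⊆ P, |∑ p ∈ Q, m p| ≤ C := by
    intro Q hQ
    have hmeas : MeasurableSet (⋃₀ (Q : Set (Set α))) :=
      MeasurableSet.sUnion Q.countable_toSet fun p hp => hP1 p (hQ hp)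
    rw [← addContent_sUnion (m := m) (fun p hp => hP1 p (hQ hp)) (hP2.subset (by simpa using hQ)) hmeas]
    exact hC _ hmeas
  have h1 : ∑ p ∈ P, |m p| ≤ 2 * C := by
    rw [← Finset.sum_filter_add_sum_filter_not P (fun p => 0 ≤ m p)]
    have e1 : ∑ p ∈ P with 0 ≤ m p, |m p| = ∑ p ∈ P with 0 ≤ m p, m p :=
      Finset.sum_congr rfl fun p hp => abs_of_nonneg (Finset.mem_filter.1 hp).2
    have e2 : ∑ p ∈ P with ¬ 0 ≤ m p, |m p| = - ∑ p ∈ P with ¬ 0 ≤ m p, m p := by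
      rw [← Finset.sum_neg_distrib]
      exact Finset.sum_congr rfl fun p hp =>
        abs_of_neg (not_le.1 (Finset.mem_filter.1 hp).2)
    rw [e1, e2]
    have a1 := (abs_le.1 (key _ (Finset.filter_subset (fun p => 0 ≤ m p) P))).2
    have a2 := (abs_le.1 (key _ (Finset.filter_subset (fun p => ¬ 0 ≤ m p) P))).1
    linarith
  calc ∑ p ∈ P, ‖m p‖ₑ = ∑ p ∈ P, ENNReal.ofReal |m p| := by
        simp [← ofReal_norm, Real.norm_eq_abs]
    _ = ENNReal.ofReal (∑ p ∈ P, |m p|) :=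
        (ENNReal.ofReal_sum_of_nonneg fun p _ => abs_nonneg _).symm
    _ ≤ _ := ENNReal.ofReal_le_ofReal h1

lemma simpleAbsIntegral_le {m : Set α → ℝ} (hm : m ∅ = 0) (s : SimpleFunc α ℝ) {K : ℝ≥0∞}
    (hs : ∀ x, ‖s x‖ₑ ≤ K) : simpleAbsIntegral m s ≤ K * totalVar m univ := by
  have hU : ⋃ y ∈ s.range, s ⁻¹' {y} = univ := by
    ext x; simp
  calc simpleAbsIntegral m s ≤ ∑ y ∈ s.range, K * totalVar m (s ⁻¹' {y}) := by
        refine Finset.sum_le_sum fun y hy => ?_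
        obtain ⟨x, rfl⟩ := SimpleFunc.mem_range.1 hy
        gcongr
        exact hs x
    _ = K * ∑ y ∈ s.range, totalVar m (s ⁻¹' {y}) := (Finset.mul_sum _ _ _).symm
    _ ≤ K * totalVar m (⋃ y ∈ s.range, s ⁻¹' {y}) := by
        gcongr
        exact sum_totalVar_le hm s.range (fun y => s.measurableSet_fiber y)
          (fun a b hab => disjoint_left.2 fun x hx hx' => hab (hx.symm.trans hx'))
    _ = _ := by rw [hU]

/-! ### Finitely additive measures induced by functionals on `L^∞` -/

variable {μ : Measure α}

open Classical in
/-- The class in `L^∞(μ)` of the indicator function of a measurable set. -/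
def indicatorClass (μ : Measure α) (A : Set α) : Lp ℝ ∞ μ :=
  if hA : MeasurableSet A then
    ((memLp_top_const (1 : ℝ)).indicator (μ := μ) hA).toLp (A.indicator fun _ => (1 : ℝ))
  else 0

lemma coeFn_indicatorClass {A : Set α} (hA : MeasurableSet A) :
    indicatorClass μ A =ᵐ[μ] A.indicator fun _ => (1 : ℝ) := by
  rw [indicatorClass, dif_pos hA]
  exact MemLp.coeFn_toLp _

lemma indicatorClass_eq_zero {A : Set α} (h : μ A = 0) : indicatorClass μ A = 0 := by
  by_cases hA : MeasurableSet A
  · rw [Lp.ext_iff]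
    refine (coeFn_indicatorClass hA).trans ?_
    refine EventuallyEq.trans ?_ (Lp.coeFn_zero _ _ _).symm
    filter_upwards [measure_eq_zero_iff_ae_notMem.1 h] with x hx
    simp [hx]
  · rw [indicatorClass, dif_neg hA]

lemma indicatorClass_union {A B : Set α} (hA : MeasurableSet A) (hB : MeasurableSet B)
    (h : Disjoint A B) :
    indicatorClass μ (A ∪ B) = indicatorClass μ A + indicatorClass μ B := by
  rw [Lp.ext_iff]
  filter_upwards [coeFn_indicatorClass (μ := μ) (hA.union hB), coeFn_indicatorClass (μ := μ) hA,
    coeFn_indicatorClass (μ := μ) hB, Lp.coeFn_add (indicatorClass μ A) (indicatorClass μ B)]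
    with x h1 h2 h3 h4
  rw [h1, h4, Pi.add_apply, h2, h3, indicator_union_of_disjoint h]

lemma norm_Linf_le {G : Type*} [NormedAddCommGroup G] {f : Lp G ∞ μ} {C : ℝ} (hC : 0 ≤ C)
    (h : ∀ᵐ x ∂μ, ‖f x‖ ≤ C) : ‖f‖ ≤ C := by
  rw [Lp.norm_def]
  refine ENNReal.toReal_le_of_le_ofReal hC ?_
  rw [eLpNorm_exponent_top]
  exact eLpNormEssSup_le_of_ae_bound h

lemma ae_norm_le_Linf {G : Type*} [NormedAddCommGroup G] (f : Lp G ∞ μ) :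
    ∀ᵐ x ∂μ, ‖f x‖ ≤ ‖f‖ := by
  filter_upwards [enorm_ae_le_eLpNormEssSup f μ] with x hx
  rw [Lp.norm_def, eLpNorm_exponent_top, ← toReal_enorm]
  refine ENNReal.toReal_mono ?_ hx
  rw [← eLpNorm_exponent_top]
  exact Lp.eLpNorm_ne_top f

lemma norm_indicatorClass_le (A : Set α) : ‖indicatorClass μ A‖ ≤ 1 := by
  by_cases hA : MeasurableSet A
  · refine norm_Linf_le zero_le_one ?_
    filter_upwards [coeFn_indicatorClass (μ := μ) hA] with x hx
    rw [hx]
    by_cases h : x ∈ A <;> simp [h]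
  · simp [indicatorClass, dif_neg hA]

lemma isSetRing_measurableSet : IsSetRing {A : Set α | MeasurableSet A} where
  empty_mem := MeasurableSet.empty
  union_mem := fun _ _ hA hB => MeasurableSet.union hA hB
  sdiff_mem := fun _ _ hA hB => MeasurableSet.diff hA hB

/-- The finitely additive measure `A ↦ ℓ(1_A)` of a linear functional `ℓ` on `L^∞(μ)`. -/
def finAddOfFunctional (ℓ : Lp ℝ ∞ μ →ₗ[ℝ] ℝ) : FinAddMeasure α :=
  isSetRing_measurableSet.addContent_of_union (fun A => ℓ (indicatorClass μ A))
    (by rw [indicatorClass_eq_zero measure_empty, map_zero])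
    (fun hA hB h => by rw [indicatorClass_union hA hB h, map_add])

lemma finAddOfFunctional_apply (ℓ : Lp ℝ ∞ μ →ₗ[ℝ] ℝ) (A : Set α) :
    finAddOfFunctional ℓ A = ℓ (indicatorClass μ A) := rfl

lemma abs_finAddOfFunctional_le {ℓ : Lp ℝ ∞ μ →ₗ[ℝ] ℝ} {C : ℝ} (hC : 0 ≤ C)
    (hℓ : ∀ f, |ℓ f| ≤ C * ‖f‖) (A : Set α) : |finAddOfFunctional ℓ A| ≤ C := by
  rw [finAddOfFunctional_apply]
  exact (hℓ _).trans (mul_le_of_le_one_right hC (norm_indicatorClass_le A))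

lemma memLp_top_simpleFunc (s : SimpleFunc α ℝ) : MemLp s ∞ μ := by
  obtain ⟨C, hC⟩ := s.exists_forall_norm_le
  exact memLp_top_of_bound s.aestronglyMeasurable C (Eventually.of_forall hC)

lemma simpleIntegral_finAddOfFunctional (ℓ : Lp ℝ ∞ μ →ₗ[ℝ] ℝ) (s : SimpleFunc α ℝ) :
    simpleIntegral (finAddOfFunctional ℓ) s = ℓ ((memLp_top_simpleFunc s).toLp s) := by
  simp only [simpleIntegral, finAddOfFunctional_apply, ← smul_eq_mul, ← map_smul, ← map_sum]
  congr 1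
  rw [Lp.ext_iff]
  have h1 : ∀ᵐ x ∂μ, ∀ y ∈ s.range, indicatorClass μ (s ⁻¹' {y}) x =
      (s ⁻¹' {y}).indicator (fun _ => (1 : ℝ)) x := by
    rw [Finset.eventually_all]
    exact fun y _ => coeFn_indicatorClass (s.measurableSet_fiber y)
  have h2 : ∀ᵐ x ∂μ, ∀ y ∈ s.range, (y • indicatorClass μ (s ⁻¹' {y}) : Lp ℝ ∞ μ) x =
      y * indicatorClass μ (s ⁻¹' {y}) x := by
    rw [Finset.eventually_all]
    exact fun y _ => Lp.coeFn_smul _ _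
  filter_upwards [h1, h2, Lp.coeFn_finsetSum s.range
    (fun y => (y • indicatorClass μ (s ⁻¹' {y}) : Lp ℝ ∞ μ)),
    MemLp.coeFn_toLp (memLp_top_simpleFunc (μ := μ) s)] with x h1 h2 h3 h4
  rw [h3, h4, Finset.sum_apply]
  rw [Finset.sum_eq_single (s x)]
  · rw [h2 _ (s.mem_range_self x), h1 _ (s.mem_range_self x)]
    simp
  · intro y hy hne
    rw [h2 y hy, h1 y hy]
    simp [Ne.symm hne]
  · exact fun h => absurd (s.mem_range_self x) h

/-- Bounded measurable functions are uniform limits of simple functions. -/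
lemma exists_simpleFunc_abs_sub_le {g : α → ℝ} (hg : Measurable g) {M : ℝ} (hM : ∀ x, |g x| ≤ M)
    {ε : ℝ} (hε : 0 < ε) : ∃ s : SimpleFunc α ℝ, ∀ x, |s x - g x| ≤ ε := by
  -- Rounding g down to the grid εℤ; boundedness of g leaves finitely many values.
  refine ⟨⟨fun x => ε * ⌊g x / ε⌋, fun y => ?_, ?_⟩, fun x => ?_⟩
  · exact ((measurable_from_top (f := fun k : ℤ => ε * (k : ℝ))).comp
      ((hg.div_const ε).floor)) (measurableSet_singleton y)
  · refine Set.Finite.subset ((Set.finite_Icc ⌊-M / ε⌋ ⌊M / ε⌋).image fun k : ℤ => ε * (k : ℝ)) ?_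
    rintro _ ⟨x, rfl⟩
    refine ⟨_, ⟨Int.floor_mono ?_, Int.floor_mono ?_⟩, rfl⟩
    · exact div_le_div_of_nonneg_right (abs_le.1 (hM x)).1 hε.le
    · exact div_le_div_of_nonneg_right (abs_le.1 (hM x)).2 hε.le
  · change |ε * (⌊g x / ε⌋ : ℝ) - g x| ≤ ε
    have h1 := Int.floor_le (g x / ε)
    have h2 := Int.lt_floor_add_one (g x / ε)
    have h3 : g x = ε * (g x / ε) := by field_simp
    rw [abs_le]
    constructor <;> nlinarith

/-- Simple functions converging uniformly off a null set form a determining sequence, since the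
induced measure has finite total variation and ignores null sets. On simple functions the integral
is ℓ by linearity, and the L^∞ bound on ℓ passes to the limit. -/
theorem hasIntegral_finAddOfFunctional {ℓ : Lp ℝ ∞ μ →ₗ[ℝ] ℝ} {C : ℝ} (hC : 0 ≤ C)
    (hℓ : ∀ f, |ℓ f| ≤ C * ‖f‖) (F : Lp ℝ ∞ μ) {f : α → ℝ} (hF : F =ᵐ[μ] f) :
    HasIntegral (finAddOfFunctional ℓ) f (ℓ F) := by
  -- Truncation at ±‖F‖ alters F only on a null set and makes it bounded at every point.
  set g : α → ℝ := fun x => max (-‖F‖) (min ‖F‖ (F x)) with hgdef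
  have hgm : Measurable g :=
    measurable_const.max (measurable_const.min (Lp.stronglyMeasurable F).measurable)
  have hgb : ∀ x, |g x| ≤ ‖F‖ := fun x =>
    abs_le.2 ⟨le_max_left _ _, max_le (by linarith [norm_nonneg F]) (min_le_left _ _)⟩
  have hgF : g =ᵐ[μ] F := by
    filter_upwards [ae_norm_le_Linf F] with x hx
    rw [Real.norm_eq_abs, abs_le] at hx
    simp only [hgdef]
    rw [min_eq_right hx.2, max_eq_right hx.1]
  have hpos : ∀ k : ℕ, (0 : ℝ) < 1 / ((k : ℝ) + 1) := fun k => Nat.one_div_pos_of_nat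
  choose s hs using fun k : ℕ => exists_simpleFunc_abs_sub_le hgm hgb (hpos k)
  have hm0 : finAddOfFunctional ℓ ∅ = 0 := addContent_empty
  have hfin : totalVar (finAddOfFunctional ℓ) univ ≤ ENNReal.ofReal (2 * C) :=
    totalVar_le_of_abs_le _ (fun A _ => abs_finAddOfFunctional_le hC hℓ A) _
  refine ⟨s, ?_, ?_, ?_⟩
  · obtain ⟨N, hN, hNm, hN0⟩ := exists_measurable_superset_of_null (ae_iff.1 (hgF.trans hF))
    intro ε hε
    have hNv : totalVar (finAddOfFunctional ℓ) N = 0 := by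
      refine totalVar_eq_zero fun B _ hBN => ?_
      rw [finAddOfFunctional_apply, indicatorClass_eq_zero (measure_mono_null hBN hN0), map_zero]
    -- Once 1/(k+1) < ε the exceptional set lies in the null set N, so its outer variation is
    -- exactly 0.
    refine tendsto_const_nhds.congr' ?_
    filter_upwards [(tendsto_one_div_add_atTop_nhds_zero_nat (𝕜 := ℝ)).eventually (gt_mem_nhds hε)]
      with k hk
    refine le_antisymm bot_le ?_
    rw [← hNv]
    refine iInf₂_le N ⟨hNm, fun x hx => ?_⟩
    by_contra hxN
    have hgx : g x = f x := by
      by_contra h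
      exact hxN (hN h)
    have := hs k x
    rw [hgx] at this
    have hx' : ε < |s k x - f x| := hx
    linarith
  · have hlim : Tendsto (fun p : ℕ × ℕ => ENNReal.ofReal (1 / ((p.1 : ℝ) + 1) + 1 / ((p.2 : ℝ) + 1)) *
        ENNReal.ofReal (2 * C)) atTop (𝓝 0) := by
      have h1 : Tendsto (fun p : ℕ × ℕ => 1 / ((p.1 : ℝ) + 1) + 1 / ((p.2 : ℝ) + 1)) atTop
          (𝓝 (0 + 0)) := by
        rw [← prod_atTop_atTop_eq]
        exact ((tendsto_one_div_add_atTop_nhds_zero_nat (𝕜 := ℝ)).comp tendsto_fst).add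
          ((tendsto_one_div_add_atTop_nhds_zero_nat (𝕜 := ℝ)).comp tendsto_snd)
      have h2 := (ENNReal.continuous_ofReal.tendsto _).comp h1
      have h3 := ENNReal.Tendsto.mul_const (b := ENNReal.ofReal (2 * C)) h2
        (Or.inr ENNReal.ofReal_ne_top)
      simpa using h3
    refine tendsto_of_tendsto_of_tendsto_of_le_of_le tendsto_const_nhds hlim (fun _ => bot_le) ?_
    rintro ⟨k, l⟩
    refine (simpleAbsIntegral_le hm0 _ fun x => ?_).trans (mul_le_mul_right hfin _)
    rw [← ofReal_norm, Real.norm_eq_abs]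
    refine ENNReal.ofReal_le_ofReal ?_
    have h1 := hs k x
    have h2 := hs l x
    calc |(s k - s l) x| = |(s k x - g x) - (s l x - g x)| := by
          rw [SimpleFunc.coe_sub, Pi.sub_apply]; congr 1; ring
      _ ≤ _ := (abs_sub _ _).trans (add_le_add h1 h2)
  · simp only [simpleIntegral_finAddOfFunctional]
    rw [tendsto_iff_dist_tendsto_zero]
    have hlim : Tendsto (fun k : ℕ => C * (1 / ((k : ℝ) + 1))) atTop (𝓝 0) := by
      simpa using (tendsto_one_div_add_atTop_nhds_zero_nat (𝕜 := ℝ)).const_mul C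
    refine squeeze_zero (fun _ => dist_nonneg) (fun k => ?_) hlim
    rw [Real.dist_eq, ← map_sub]
    refine (hℓ _).trans (mul_le_mul_of_nonneg_left (norm_Linf_le (hpos k).le ?_) hC)
    filter_upwards [Lp.coeFn_sub ((memLp_top_simpleFunc (μ := μ) (s k)).toLp (s k)) F,
      MemLp.coeFn_toLp (memLp_top_simpleFunc (μ := μ) (s k)), hgF] with x h1 h2 h3
    rw [h1, Pi.sub_apply, h2, ← h3]
    exact hs k x

end FinitelyAdditiveLemmas

/-! ### Mollification and the continuous representative of a W^{1,∞} function -/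

section Mollification

open scoped Convolution

variable {n : ℕ}

/-- A sequence of bump functions at the origin with radii tending to zero. -/
def mollifier (n k : ℕ) : ContDiffBump (0 : Euc n) where
  rIn := 1 / ((k : ℝ) + 1) / 2
  rOut := 1 / ((k : ℝ) + 1)
  rIn_pos := half_pos Nat.one_div_pos_of_nat
  rIn_lt_rOut := half_lt_self Nat.one_div_pos_of_nat

lemma tendsto_mollifier_rOut (n : ℕ) : Tendsto (fun k => (mollifier n k).rOut) atTop (𝓝 0) :=
  tendsto_one_div_add_atTop_nhds_zero_nat

/-- The convolution of a function with the `k`-th mollifier. -/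
def mollify {E : Type*} [NormedAddCommGroup E] [NormedSpace ℝ E] (k : ℕ) (f : Euc n → E) :
    Euc n → E :=
  (mollifier n k).normed volume ⋆[ContinuousLinearMap.lsmul ℝ ℝ, volume] f

section General

variable {E : Type*} [NormedAddCommGroup E] [NormedSpace ℝ E]

lemma hasCompactSupport_mollifier (k : ℕ) :
    HasCompactSupport ((mollifier n k).normed volume) :=
  (mollifier n k).hasCompactSupport_normed

lemma contDiff_mollifier (k : ℕ) {m : ℕ∞} : ContDiff ℝ m ((mollifier n k).normed volume) :=
  (mollifier n k).contDiff_normed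

lemma contDiff_mollify (k : ℕ) {f : Euc n → E} (hf : LocallyIntegrable f volume) :
    ContDiff ℝ ∞ (mollify k f) :=
  (hasCompactSupport_mollifier k).contDiff_convolution_left _ (contDiff_mollifier k) hf

lemma ae_tendsto_mollify [CompleteSpace E] {f : Euc n → E} (hf : LocallyIntegrable f volume) :
    ∀ᵐ x, Tendsto (fun k => mollify k f x) atTop (𝓝 (f x)) :=
  -- The constant 2 is the ratio of the outer to the inner radius of each mollifier.
  ContDiffBump.ae_convolution_tendsto_right_of_locallyIntegrable (K := 2)
    (tendsto_mollifier_rOut n) (Eventually.of_forall fun k => by simp [mollifier]; ring_nf; rfl) hf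

lemma norm_mollify_le (k : ℕ) {f : Euc n → E} {M : ℝ} (hf : ∀ᵐ x, ‖f x‖ ≤ M) (x : Euc n) :
    ‖mollify k f x‖ ≤ M := by
  have h1 : ∫ t, (mollifier n k).normed volume t * M = M := by
    rw [integral_mul_const, ContDiffBump.integral_normed, one_mul]
  rw [← h1]
  refine norm_integral_le_of_norm_le ((mollifier n k).integrable_normed.mul_const M) ?_
  filter_upwards [(Measure.measurePreserving_sub_left volume x).quasiMeasurePreserving.ae hf] with t ht
  rw [ContinuousLinearMap.lsmul_apply, norm_smul, Real.norm_of_nonneg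
    ((mollifier n k).nonneg_normed t)]
  exact mul_le_mul_of_nonneg_left ht ((mollifier n k).nonneg_normed t)

lemma mollify_eq_integral (k : ℕ) (f : Euc n → E) (x : Euc n) :
    mollify k f x = ∫ t, (mollifier n k).normed volume (x - t) • f t :=
  convolution_eq_swap _

lemma fderiv_mollify_apply (k : ℕ) {f : Euc n → ℝ} (hf : LocallyIntegrable f volume)
    (x v : Euc n) : fderiv ℝ (mollify k f) x v =
      ∫ t, fderiv ℝ ((mollifier n k).normed volume) (x - t) v * f t := by
  have h1 := ((hasCompactSupport_mollifier (n := n) k).hasFDerivAt_convolution_left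
    (ContinuousLinearMap.lsmul ℝ ℝ) (contDiff_mollifier k (m := 1)) hf x).fderiv
  have h2 : ConvolutionExistsAt (fderiv ℝ ((mollifier n k).normed volume)) f x
      ((ContinuousLinearMap.lsmul ℝ ℝ).precompL (Euc n)) volume :=
    ((hasCompactSupport_mollifier (n := n) k).fderiv ℝ).convolutionExists_left _
      ((contDiff_mollifier k (m := 1)).continuous_fderiv (by simp)) hf x
  unfold mollify
  rw [h1, convolution_eq_swap, ContinuousLinearMap.integral_apply
    (convolutionExistsAt_iff_integrable_swap.1 h2)]
  rfl

end General

variable {U : Set (Euc n)}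

lemma isTest_mollifier_sub (k : ℕ) {x : Euc n}
    (hx : Metric.closedBall x (mollifier n k).rOut ⊆ U) :
    IsTest U fun t => (mollifier n k).normed volume (x - t) := by
  have hts : tsupport (fun t => (mollifier n k).normed volume (x - t)) ⊆
      Metric.closedBall x (mollifier n k).rOut := by
    refine closure_minimal (fun t ht => ?_) Metric.isClosed_closedBall
    have : x - t ∈ Function.support ((mollifier n k).normed volume) := ht
    rw [ContDiffBump.support_normed_eq, mem_ball_zero_iff, ← dist_eq_norm] at this
    rw [Metric.mem_closedBall, dist_comm]
    exact this.le
  exact ⟨(contDiff_mollifier k).comp (contDiff_const.sub contDiff_id),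
    (isCompact_closedBall _ _).of_isClosed_subset (isClosed_tsupport _) hts, hts.trans hx⟩

/-- Apply the definition of the weak gradient to t ↦ ρ_k(x − t), a test function on U when the
mollifier's ball about x stays in U. The sign from the inner derivative cancels the one from
integration by parts. -/
lemma fderiv_mollify_of_isWeakGrad (hU : MeasurableSet U) {φ : Euc n → ℝ} {G : Euc n → Euc n}
    (hφ : LocallyIntegrable (U.indicator φ) volume)
    (hG : LocallyIntegrable (U.indicator G) volume) (h : IsWeakGrad U φ G) (k : ℕ)
    {x : Euc n} (hx : Metric.closedBall x (mollifier n k).rOut ⊆ U) (v : Euc n) :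
    fderiv ℝ (mollify k (U.indicator φ)) x v = inner ℝ (mollify k (U.indicator G) x) v := by
  have key : (fderiv ℝ (mollify k (U.indicator φ)) x : Euc n →ₗ[ℝ] ℝ) =
      (innerSL ℝ (mollify k (U.indicator G) x) : Euc n →ₗ[ℝ] ℝ) := by
    refine (EuclideanSpace.basisFun (Fin n) ℝ).toBasis.ext fun i => ?_
    simp only [OrthonormalBasis.coe_toBasis, EuclideanSpace.basisFun_apply,
      ContinuousLinearMap.coe_coe, innerSL_apply_apply]
    rw [fderiv_mollify_apply k hφ, mollify_eq_integral, real_inner_comm,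
      EuclideanSpace.inner_single_left, map_one, one_mul]
    have hint : Integrable (fun t => (mollifier n k).normed volume (x - t) • U.indicator G t) :=
      convolutionExistsAt_iff_integrable_swap.1
        ((hasCompactSupport_mollifier (n := n) k).convolutionExists_left
          (ContinuousLinearMap.lsmul ℝ ℝ) (contDiff_mollifier k (m := 0)).continuous hG x)
    have h1 := (EuclideanSpace.proj i : Euc n →L[ℝ] ℝ).integral_comp_comm hint
    simp only [PiLp.proj_apply, PiLp.smul_apply, smul_eq_mul] at h1
    rw [← h1]
    have h2 := h _ (isTest_mollifier_sub k hx) i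
    rw [← integral_indicator hU, ← integral_indicator hU] at h2
    have h3 : ∀ t, fderiv ℝ (fun t => (mollifier n k).normed volume (x - t)) t
        (EuclideanSpace.single i 1) =
        - fderiv ℝ ((mollifier n k).normed volume) (x - t) (EuclideanSpace.single i 1) := by
      intro t
      have hd : HasFDerivAt ((mollifier n k).normed volume)
          (fderiv ℝ ((mollifier n k).normed volume) (x - t)) (x - t) :=
        ((contDiff_mollifier k (m := 1)).differentiable (by simp) _).hasFDerivAt
      have h := hd.comp t ((hasFDerivAt_id t).const_sub x)
      have h' : HasFDerivAt (fun t => (mollifier n k).normed volume (x - t)) _ t := h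
      rw [h'.fderiv]
      simp
    have h4 : ∀ t, U.indicator (fun x_1 => φ x_1 * fderiv ℝ (fun t =>
        (mollifier n k).normed volume (x - t)) x_1 (EuclideanSpace.single i 1)) t =
        - (fderiv ℝ ((mollifier n k).normed volume) (x - t) (EuclideanSpace.single i 1) *
          U.indicator φ t) := by
      intro t
      by_cases ht : t ∈ U
      · simp only [indicator_of_mem ht, h3]; ring
      · simp [indicator_of_notMem ht]
    have h5 : ∀ t, U.indicator (fun x_1 => G x_1 i * (mollifier n k).normed volume (x - x_1)) t =
        (mollifier n k).normed volume (x - t) * U.indicator G t i := by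
      intro t
      by_cases ht : t ∈ U
      · simp only [indicator_of_mem ht]; ring
      · simp [indicator_of_notMem ht]
    simp only [h4, h5, integral_neg] at h2
    exact neg_injective h2
  exact LinearMap.congr_fun key v

lemma memLp_indicator_Linf {E : Type*} [NormedAddCommGroup E] (hU : MeasurableSet U)
    (f : Linf U E) : MemLp (U.indicator f) ∞ volume :=
  (memLp_indicator_iff_restrict hU).2 (Lp.memLp f)

lemma locallyIntegrable_indicator_Linf {E : Type*} [NormedAddCommGroup E] (hU : MeasurableSet U)
    (f : Linf U E) : LocallyIntegrable (U.indicator f) volume :=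
  (memLp_indicator_Linf hU f).locallyIntegrable le_top

lemma ae_norm_indicator_Linf_le {E : Type*} [NormedAddCommGroup E] (hU : MeasurableSet U)
    (f : Linf U E) : ∀ᵐ x, ‖U.indicator f x‖ ≤ ‖f‖ := by
  have h := (ae_restrict_iff' hU).1 (ae_norm_le_Linf f)
  filter_upwards [h] with x hx
  by_cases hxU : x ∈ U
  · simpa [hxU] using hx hxU
  · simp [hxU]

/-- Approximation of `φ ∈ L^∞(U)` with weak gradient `G ∈ L^∞(U)` by smooth functions `f k`, with
gradients `g k` on compact subsets of `U`; the limit `φt` is the continuous representative. -/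
structure IsSmoothApprox (U : Set (Euc n)) (φ : Linf U ℝ) (G : Linf U (Euc n)) (φt : Euc n → ℝ)
    (f : ℕ → Euc n → ℝ) (g : ℕ → Euc n → Euc n) : Prop where
  contDiff : ∀ k, ContDiff ℝ ∞ (f k)
  continuous_grad : ∀ k, Continuous (g k)
  abs_le : ∀ k x, |f k x| ≤ ‖φ‖
  norm_grad_le : ∀ k x, ‖g k x‖ ≤ ‖G‖
  continuousOn : ContinuousOn φt U
  ae_eq : φt =ᵐ[volume.restrict U] φ
  tendsto : ∀ x ∈ U, Tendsto (fun k => f k x) atTop (𝓝 (φt x))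
  tendsto_grad : ∀ᵐ x ∂(volume.restrict U), Tendsto (fun k => g k x) atTop (𝓝 (G x))
  fderiv_eq : ∀ K ⊆ U, IsCompact K → ∀ᶠ k in atTop, ∀ x ∈ K, ∀ v,
    fderiv ℝ (f k) x v = inner ℝ (g k x) v

/-- A local uniform Lipschitz bound spreads convergence from a dense set to all of U, and the limit
inherits the bound. -/
lemma exists_tendsto_of_eventually_lipschitz {U : Set (Euc n)} {f : ℕ → Euc n → ℝ} {M : ℝ}
    (hM0 : 0 ≤ M)
    (hlip : ∀ x ∈ U, ∃ r > 0, Metric.closedBall x r ⊆ U ∧ ∀ᶠ k in atTop,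
      ∀ y ∈ Metric.closedBall x r, ∀ z ∈ Metric.closedBall x r, |f k z - f k y| ≤ M * ‖z - y‖)
    {f0 : Euc n → ℝ} (hdense : Dense {y : Euc n | Tendsto (fun k => f k y) atTop (𝓝 (f0 y))}) :
    ∃ φt : Euc n → ℝ, ContinuousOn φt U ∧ ∀ x ∈ U, Tendsto (fun k => f k x) atTop (𝓝 (φt x)) := by
  have hcauchy : ∀ x ∈ U, CauchySeq fun k => f k x := by
    intro x hx
    obtain ⟨r, hr, hrU, hk⟩ := hlip x hx
    rw [Metric.cauchySeq_iff']
    intro ε hε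
    -- This radius makes each of the two Lipschitz errors at most ε/4; `M + 1` keeps the denominator
    -- positive when M = 0.
    have hρ : 0 < min r (ε / (4 * (M + 1))) := lt_min hr (by positivity)
    obtain ⟨y, hy, hyx⟩ := Metric.dense_iff.1 hdense x _ hρ
    have hyr : y ∈ Metric.closedBall x r :=
      Metric.mem_closedBall.2 ((Metric.mem_ball.1 hy).le.trans (min_le_left _ _))
    have hyε : M * ‖x - y‖ ≤ ε / 4 := by
      have h1 : ‖x - y‖ ≤ ε / (4 * (M + 1)) := by
        rw [← dist_eq_norm, dist_comm]
        exact (Metric.mem_ball.1 hy).le.trans (min_le_right _ _)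
      calc M * ‖x - y‖ ≤ (M + 1) * (ε / (4 * (M + 1))) := by gcongr; linarith
        _ = ε / 4 := by field_simp
    obtain ⟨N1, hN1⟩ := eventually_atTop.1 hk
    obtain ⟨N2, hN2⟩ := Metric.cauchySeq_iff.1 (Tendsto.cauchySeq hyx) (ε / 4) (by positivity)
    refine ⟨max N1 N2, fun k hkN => ?_⟩
    have a1 := hN1 k ((le_max_left _ _).trans hkN) y hyr x (Metric.mem_closedBall_self hr.le)
    have a2 := hN1 (max N1 N2) (le_max_left _ _) y hyr x (Metric.mem_closedBall_self hr.le)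
    have a3 := hN2 k ((le_max_right _ _).trans hkN) (max N1 N2) (le_max_right _ _)
    rw [Real.dist_eq] at a3 ⊢
    rw [abs_le] at a1 a2
    rw [abs_lt] at a3 ⊢
    constructor <;> linarith
  have hlim : ∀ x ∈ U, Tendsto (fun k => f k x) atTop (𝓝 (limUnder atTop fun k => f k x)) :=
    fun x hx => tendsto_nhds_limUnder (cauchySeq_tendsto_of_complete (hcauchy x hx))
  refine ⟨fun x => limUnder atTop fun k => f k x, fun x hx => ?_, hlim⟩
  obtain ⟨r, hr, hrU, hk⟩ := hlip x hx
  refine ContinuousAt.continuousWithinAt ?_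
  refine continuousAt_of_locally_lipschitz hr M fun y hy => ?_
  have hy' : y ∈ Metric.closedBall x r := Metric.mem_closedBall.2 (le_of_lt hy)
  rw [Real.dist_eq, dist_eq_norm]
  refine le_of_tendsto (((hlim y (hrU hy')).sub (hlim x hx)).abs) ?_
  filter_upwards [hk] with k hk
  exact hk x (Metric.mem_closedBall_self hr.le) y hy'

/-- On a closed ball inside U the gradients of the mollifications are eventually mollifications of
G, hence bounded by ‖G‖. The resulting Lipschitz bound upgrades a.e. convergence to convergence at
every point of U. -/
theorem exists_isSmoothApprox (hU : IsOpen U) {φ : Linf U ℝ} {G : Linf U (Euc n)}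
    (hG : IsWeakGrad U φ G) : ∃ φt f g, IsSmoothApprox U φ G φt f g := by
  have hUm := hU.measurableSet
  have hli := locallyIntegrable_indicator_Linf hUm φ
  have hlg := locallyIntegrable_indicator_Linf hUm G
  have hcd : ∀ k, ContDiff ℝ ∞ (mollify k (U.indicator φ)) := fun k => contDiff_mollify k hli
  have hfd : ∀ K ⊆ U, IsCompact K → ∀ᶠ k in atTop, ∀ x ∈ K, ∀ v,
      fderiv ℝ (mollify k (U.indicator φ)) x v = inner ℝ (mollify k (U.indicator G) x) v := by
    intro K hKU hK
    obtain ⟨r, hr, hrU⟩ := hK.exists_cthickening_subset_open hU hKU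
    filter_upwards [(tendsto_mollifier_rOut n).eventually (ge_mem_nhds hr)] with k hk x hx v
    refine fderiv_mollify_of_isWeakGrad hUm hli hlg hG k ?_ v
    exact (Metric.closedBall_subset_closedBall hk).trans
      ((Metric.closedBall_subset_cthickening hx r).trans hrU)
  have hgb : ∀ k x, ‖mollify k (U.indicator G) x‖ ≤ ‖G‖ := fun k x =>
    norm_mollify_le k (ae_norm_indicator_Linf_le hUm _) x
  have hlip : ∀ x ∈ U, ∃ r > 0, Metric.closedBall x r ⊆ U ∧ ∀ᶠ k in atTop,
      ∀ y ∈ Metric.closedBall x r, ∀ z ∈ Metric.closedBall x r,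
        |mollify k (U.indicator φ) z - mollify k (U.indicator φ) y| ≤ ‖G‖ * ‖z - y‖ := by
    intro x hx
    obtain ⟨r, hr, hrU⟩ := Metric.nhds_basis_closedBall.mem_iff.1 (hU.mem_nhds hx)
    refine ⟨r, hr, hrU, ?_⟩
    filter_upwards [hfd _ hrU (isCompact_closedBall x r)] with k hk y hy z hz
    refine (convex_closedBall x r).norm_image_sub_le_of_norm_fderiv_le
      (𝕜 := ℝ) (fun w _ => (hcd k).differentiable (by simp) w) (fun w hw => ?_) hy hz
    refine ContinuousLinearMap.opNorm_le_bound _ (norm_nonneg _) fun v => ?_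
    rw [hk w hw v]
    exact (norm_inner_le_norm _ _).trans (mul_le_mul_of_nonneg_right (hgb k w) (norm_nonneg v))
  have hae := ae_tendsto_mollify hli
  obtain ⟨φt, hct, hlim⟩ := exists_tendsto_of_eventually_lipschitz (norm_nonneg G) hlip
    (Measure.dense_of_ae hae)
  refine ⟨φt, _, fun k => mollify k (U.indicator G), ⟨hcd,
    fun k => (contDiff_mollify k hlg).continuous,
    fun k x => by
      rw [← Real.norm_eq_abs]
      exact norm_mollify_le k (ae_norm_indicator_Linf_le hUm φ) x, hgb, hct, ?_, hlim, ?_, hfd⟩⟩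
  · refine (ae_restrict_iff' hUm).2 ?_
    filter_upwards [hae] with x hx hxU
    rw [indicator_of_mem hxU] at hx
    exact tendsto_nhds_unique (hlim x hxU) hx
  · refine (ae_restrict_iff' hUm).2 ?_
    filter_upwards [ae_tendsto_mollify hlg] with x hx hxU
    rw [indicator_of_mem hxU] at hx
    exact hx

end Mollification

/-! ### Integrals against signed measures -/

section SignedMeasureIntegral

variable {α : Type*} [MeasurableSpace α]

lemma integral_toSignedMeasure_sub {μ₁ μ₂ : Measure α} [IsFiniteMeasure μ₁] [IsFiniteMeasure μ₂]
    {ψ : α → ℝ} (h1 : Integrable ψ μ₁) (h2 : Integrable ψ μ₂) :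
    ∫ᵛ x, ψ x ∂•(μ₁.toSignedMeasure - μ₂.toSignedMeasure) = ∫ x, ψ x ∂μ₁ - ∫ x, ψ x ∂μ₂ := by
  have hflip : (ContinuousLinearMap.lsmul ℝ ℝ : ℝ →L[ℝ] ℝ →L[ℝ] ℝ) =
      (ContinuousLinearMap.lsmul ℝ ℝ : ℝ →L[ℝ] ℝ →L[ℝ] ℝ).flip := by
    ext; simp
  rw [VectorMeasure.integral_sub_vectorMeasure, hflip, VectorMeasure.integral_toSignedMeasure,
    VectorMeasure.integral_toSignedMeasure]
  · rwa [VectorMeasure.Integrable, Measure.variation_toSignedMeasure]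
  · rwa [VectorMeasure.Integrable, Measure.variation_toSignedMeasure]

lemma integral_withDensityᵥ {m : Measure α} {h : α → ℝ} (hh : Integrable h m) {ψ : α → ℝ}
    (hψ : Measurable ψ) {C : ℝ} (hC : ∀ x, |ψ x| ≤ C) :
    ∫ᵛ x, ψ x ∂•(m.withDensityᵥ h) = ∫ x, ψ x * h x ∂m := by
  have f1 : IsFiniteMeasure (m.withDensity fun x => ENNReal.ofReal (h x)) :=
    isFiniteMeasure_withDensity_ofReal hh.2
  have f2 : IsFiniteMeasure (m.withDensity fun x => ENNReal.ofReal (-h x)) :=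
    isFiniteMeasure_withDensity_ofReal hh.neg.2
  rw [withDensityᵥ_eq_withDensity_pos_part_sub_withDensity_neg_part hh,
    integral_toSignedMeasure_sub
      (Integrable.of_bound hψ.aestronglyMeasurable C (Eventually.of_forall hC))
      (Integrable.of_bound hψ.aestronglyMeasurable C (Eventually.of_forall hC)),
    integral_withDensity_eq_integral_toReal_smul₀ hh.aemeasurable.ennreal_ofReal
      (Eventually.of_forall fun _ => ENNReal.ofReal_lt_top),
    integral_withDensity_eq_integral_toReal_smul₀ (f := fun x => ENNReal.ofReal (-h x))
      hh.neg.aemeasurable.ennreal_ofReal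
      (Eventually.of_forall fun _ => ENNReal.ofReal_lt_top), ← integral_sub]
  · refine integral_congr_ae (Eventually.of_forall fun x => ?_)
    simp only [ENNReal.toReal_ofReal', smul_eq_mul]
    rcases le_total 0 (h x) with h0 | h0
    · rw [max_eq_left h0, max_eq_right (by linarith)]; ring
    · rw [max_eq_right h0, max_eq_left (by linarith)]; ring
  · simp only [ENNReal.toReal_ofReal', smul_eq_mul]
    exact hh.pos_part.mul_bdd (c := C) hψ.aestronglyMeasurable (Eventually.of_forall hC)
  · simp only [ENNReal.toReal_ofReal', smul_eq_mul]
    exact hh.neg.pos_part.mul_bdd (c := C) hψ.aestronglyMeasurable (Eventually.of_forall hC)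

lemma isFiniteMeasure_totalVariation (ν : SignedMeasure α) : IsFiniteMeasure ν.totalVariation := by
  unfold SignedMeasure.totalVariation
  infer_instance

lemma signedMeasure_integrable (ν : SignedMeasure α) {ψ : α → ℝ} (hψ : Measurable ψ) {C : ℝ}
    (hC : ∀ x, |ψ x| ≤ C) : ν.Integrable ψ := by
  have : IsFiniteMeasure ν.variation := by
    rw [← SignedMeasure.totalVariation_eq_variation]
    exact isFiniteMeasure_totalVariation ν
  exact Integrable.of_bound hψ.aestronglyMeasurable C (Eventually.of_forall hC)

/-- Radon–Nikodym with respect to the total variation. Writing ν as a density turns integrals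
against it into Bochner integrals, for which dominated convergence is at hand. -/
lemma exists_eq_withDensityᵥ (ν : SignedMeasure α) :
    ∃ (m : Measure α) (h : α → ℝ), Integrable h m ∧ ν = m.withDensityᵥ h := by
  have := isFiniteMeasure_totalVariation ν
  refine ⟨ν.totalVariation, ν.rnDeriv ν.totalVariation,
    SignedMeasure.integrable_rnDeriv _ _, ?_⟩
  refine (SignedMeasure.withDensityᵥ_rnDeriv_eq ν _ ?_).symm
  refine VectorMeasure.AbsolutelyContinuous.mk fun s hs h0 => ?_
  rw [Measure.toENNRealVectorMeasure_apply_measurable hs] at h0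
  exact SignedMeasure.null_of_totalVariation_zero ν h0

end SignedMeasureIntegral

/-! ### Divergence measures and the product rule -/

section Divergence

variable {n : ℕ} {U : Set (Euc n)}

lemma IsTest.exists_abs_le {ψ : Euc n → ℝ} (hψ : IsTest U ψ) : ∃ C, ∀ x, |ψ x| ≤ C :=
  hψ.2.1.exists_bound_of_continuous hψ.1.continuous

/-- A signed measure concentrated on an open set is determined by its action on test functions. -/
lemma signedMeasure_eq_zero_of_test (hU : IsOpen U) {ν : SignedMeasure (Euc n)}
    (h0 : ∀ A, MeasurableSet A → A ⊆ Uᶜ → ν A = 0)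
    (h : ∀ ψ : Euc n → ℝ, IsTest U ψ → ∫ᵛ x, ψ x ∂•ν = 0) : ν = 0 := by
  obtain ⟨m, d, hd, rfl⟩ := exists_eq_withDensityᵥ ν
  have hae : ∀ᵐ x ∂m, x ∈ U → d x = 0 := by
    refine hU.ae_eq_zero_of_integral_contDiff_smul_eq_zero
      (hd.locallyIntegrable.locallyIntegrableOn U) fun g h1 h2 h3 => ?_
    obtain ⟨C, hC⟩ := IsTest.exists_abs_le ⟨h1, h2, h3⟩
    have := h g ⟨h1, h2, h3⟩
    rwa [integral_withDensityᵥ hd h1.continuous.measurable hC] at this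
  ext A hA
  have hAU := hA.inter hU.measurableSet
  have hAU' := hA.diff hU.measurableSet
  rw [← inter_union_sdiff A U, VectorMeasure.of_union disjoint_sdiff_inter.symm hAU hAU',
    h0 _ hAU' (fun x hx => hx.2), withDensityᵥ_apply hd hAU,
    setIntegral_eq_zero_of_ae_eq_zero]
  · simp
  · filter_upwards [hae] with x hx hxA using hx hxA.2

/-- Uniqueness lets `divMeasure`, defined by choice, be computed from any divergence measure found.
-/
lemma IsDivMeasure.unique (hU : IsOpen U) {F : Euc n → Euc n} {ν₁ ν₂ : SignedMeasure (Euc n)}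
    (h1 : IsDivMeasure U F ν₁) (h2 : IsDivMeasure U F ν₂) : ν₁ = ν₂ := by
  rw [← sub_eq_zero]
  refine signedMeasure_eq_zero_of_test hU (fun A hA hAU => ?_) fun ψ hψ => ?_
  · rw [sub_apply, h1.1 A hA hAU, h2.1 A hA hAU, sub_zero]
  · have a1 := h1.2 ψ hψ
    have a2 := h2.2 ψ hψ
    obtain ⟨C, hC⟩ := hψ.exists_abs_le
    rw [VectorMeasure.integral_sub_vectorMeasure
      (signedMeasure_integrable _ hψ.1.continuous.measurable hC)
      (signedMeasure_integrable _ hψ.1.continuous.measurable hC)]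
    linarith

lemma divMeasure_eq (hU : IsOpen U) {F : Euc n → Euc n} {ν : SignedMeasure (Euc n)}
    (h : IsDivMeasure U F ν) : divMeasure U F = ν := by
  have hex : ∃ ν : SignedMeasure (Euc n), IsDivMeasure U F ν := ⟨ν, h⟩
  rw [divMeasure, dif_pos hex]
  exact hex.choose_spec.unique hU h

lemma IsTest.exists_fderiv_le {ψ : Euc n → ℝ} (hψ : IsTest U ψ) :
    ∃ C, 0 ≤ C ∧ ∀ x v, |fderiv ℝ ψ x v| ≤ C * ‖v‖ := by
  obtain ⟨C, hC⟩ := (hψ.2.1.fderiv ℝ).exists_bound_of_continuous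
    (hψ.1.continuous_fderiv (by simp))
  exact ⟨C, (norm_nonneg _).trans (hC 0), fun x v =>
    ((fderiv ℝ ψ x).le_opNorm v).trans (mul_le_mul_of_nonneg_right (hC x) (norm_nonneg v))⟩

lemma IsTest.aestronglyMeasurable_fderiv {ψ : Euc n → ℝ} (hψ : IsTest U ψ) {F : Euc n → Euc n}
    {μ : Measure (Euc n)} (hF : AEStronglyMeasurable F μ) :
    AEStronglyMeasurable (fun x => fderiv ℝ ψ x (F x)) μ :=
  (isBoundedBilinearMap_apply (𝕜 := ℝ)).continuous.comp_aestronglyMeasurable₂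
    (hψ.1.continuous_fderiv (by simp)).aestronglyMeasurable hF

lemma IsTest.integrable_fderiv {ψ : Euc n → ℝ} (hψ : IsTest U ψ) {F : Euc n → Euc n}
    {μ : Measure (Euc n)} (hF : Integrable F μ) :
    Integrable (fun x => fderiv ℝ ψ x (F x)) μ := by
  obtain ⟨C, -, hC⟩ := hψ.exists_fderiv_le
  exact (hF.norm.const_mul C).mono' (hψ.aestronglyMeasurable_fderiv hF.1)
    (Eventually.of_forall fun x => hC x _)

lemma IsDivMeasure.congr {F G : Euc n → Euc n} {ν : SignedMeasure (Euc n)}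
    (h : IsDivMeasure U F ν) (hFG : F =ᵐ[volume.restrict U] G) : IsDivMeasure U G ν := by
  refine ⟨h.1, fun ψ hψ => ?_⟩
  rw [← h.2 ψ hψ]
  refine integral_congr_ae ?_
  filter_upwards [hFG] with x hx
  rw [hx]

lemma IsDivMeasure.add {F G : Euc n → Euc n} {ν₁ ν₂ : SignedMeasure (Euc n)}
    (h1 : IsDivMeasure U F ν₁) (h2 : IsDivMeasure U G ν₂) (hF : IntegrableOn F U)
    (hG : IntegrableOn G U) : IsDivMeasure U (fun x => F x + G x) (ν₁ + ν₂) := by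
  refine ⟨fun A hA hAU => by rw [add_apply, h1.1 A hA hAU, h2.1 A hA hAU, add_zero],
    fun ψ hψ => ?_⟩
  obtain ⟨C, hC⟩ := hψ.exists_abs_le
  simp only [map_add]
  rw [integral_add (hψ.integrable_fderiv hF) (hψ.integrable_fderiv hG), h1.2 ψ hψ, h2.2 ψ hψ,
    VectorMeasure.integral_add_vectorMeasure
      (signedMeasure_integrable _ hψ.1.continuous.measurable hC)
      (signedMeasure_integrable _ hψ.1.continuous.measurable hC)]
  ring

lemma IsDivMeasure.const_smul {F : Euc n → Euc n} {ν : SignedMeasure (Euc n)}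
    (h : IsDivMeasure U F ν) (c : ℝ) : IsDivMeasure U (fun x => c • F x) (c • ν) := by
  refine ⟨fun A hA hAU => by rw [smul_apply, h.1 A hA hAU, smul_zero], fun ψ hψ => ?_⟩
  simp only [map_smul, smul_eq_mul]
  rw [integral_const_mul, h.2 ψ hψ, VectorMeasure.integral_smul_vectorMeasure, smul_eq_mul]
  ring

/-! ### The product of a Lipschitz function and a divergence measure field -/

variable {φ : Linf U ℝ} {G : Linf U (Euc n)} {φt : Euc n → ℝ} {f : ℕ → Euc n → ℝ}
  {g : ℕ → Euc n → Euc n}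

lemma IsSmoothApprox.abs_limit_le (H : IsSmoothApprox U φ G φt f g) {x : Euc n} (hx : x ∈ U) :
    |φt x| ≤ ‖φ‖ :=
  le_of_tendsto (H.tendsto x hx).abs (Eventually.of_forall fun k => H.abs_le k x)

lemma IsSmoothApprox.tendsto_indicator (H : IsSmoothApprox U φ G φt f g) (x : Euc n) :
    Tendsto (fun k => U.indicator (f k) x) atTop (𝓝 (U.indicator φt x)) := by
  by_cases hx : x ∈ U
  · simpa [hx] using H.tendsto x hx
  · simp [hx]

lemma IsSmoothApprox.measurable_indicator (H : IsSmoothApprox U φ G φt f g)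
    (hU : MeasurableSet U) : Measurable (U.indicator φt) :=
  measurable_of_tendsto_metrizable
    (fun k => (H.contDiff k).continuous.measurable.indicator hU)
    (tendsto_pi_nhds.2 H.tendsto_indicator)

lemma IsSmoothApprox.abs_indicator_le (H : IsSmoothApprox U φ G φt f g) (x : Euc n) :
    |U.indicator φt x| ≤ ‖φ‖ := by
  by_cases hx : x ∈ U
  · simpa [hx] using H.abs_limit_le hx
  · simp [hx]

lemma IsSmoothApprox.integrable_mul (H : IsSmoothApprox U φ G φt f g) (hU : MeasurableSet U)
    {m : Measure (Euc n)} {h : Euc n → ℝ} (hh : Integrable h m) :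
    Integrable (fun x => U.indicator φt x * h x) m :=
  hh.bdd_mul (c := ‖φ‖) (H.measurable_indicator hU).aestronglyMeasurable
    (Eventually.of_forall H.abs_indicator_le)

lemma integrableOn_inner_Linf {F : Euc n → Euc n} (hF : IntegrableOn F U) (G : Linf U (Euc n)) :
    IntegrableOn (fun x => inner ℝ (G x) (F x)) U := by
  refine (hF.norm.const_mul ‖G‖).mono' ((Lp.aestronglyMeasurable G).inner hF.1) ?_
  filter_upwards [ae_norm_le_Linf G] with x hx
  exact (norm_inner_le_norm _ _).trans (mul_le_mul_of_nonneg_right hx (norm_nonneg _))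

lemma integrableOn_smul_Linf {F : Euc n → Euc n} (hF : IntegrableOn F U) (φ : Linf U ℝ) :
    IntegrableOn (fun x => φ x • F x) U :=
  hF.essSup_smul (Lp.aestronglyMeasurable φ) (Lp.eLpNorm_lt_top φ).ne

/-- The divergence of `φ F` is `φ div F + Dφ · F`. -/
theorem IsSmoothApprox.isDivMeasure (H : IsSmoothApprox U φ G φt f g) (hU : IsOpen U)
    {F : Euc n → Euc n} (hF : IntegrableOn F U) {m : Measure (Euc n)} {h : Euc n → ℝ}
    (hh : Integrable h m) (hdiv : IsDivMeasure U F (m.withDensityᵥ h)) :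
    IsDivMeasure U (fun x => φ x • F x) (m.withDensityᵥ (fun x => U.indicator φt x * h x) +
      volume.withDensityᵥ (U.indicator fun x => inner ℝ (G x) (F x))) := by
  have hUm := hU.measurableSet
  have hA := H.integrable_mul hUm hh
  have hGF := integrableOn_inner_Linf hF G
  have hB : Integrable (U.indicator fun x => inner ℝ (G x) (F x)) :=
    (integrable_indicator_iff hUm).2 hGF
  refine ⟨fun A hA' hAU => ?_, fun ψ hψ => ?_⟩
  · rw [add_apply, withDensityᵥ_apply hA hA', withDensityᵥ_apply hB hA',
      setIntegral_eq_zero_of_forall_eq_zero, setIntegral_eq_zero_of_forall_eq_zero, add_zero]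
    · intro x hx
      rw [indicator_of_notMem (hAU hx)]
    · intro x hx
      rw [indicator_of_notMem (hAU hx), zero_mul]
  obtain ⟨C, hC⟩ := hψ.exists_abs_le
  obtain ⟨C', hC'0, hC'⟩ := hψ.exists_fderiv_le
  have hψm : Measurable ψ := hψ.1.continuous.measurable
  rw [VectorMeasure.integral_add_vectorMeasure (signedMeasure_integrable _ hψm hC)
    (signedMeasure_integrable _ hψm hC), integral_withDensityᵥ hA hψm hC,
    integral_withDensityᵥ hB hψm hC]
  have L1 : Tendsto (fun k => ∫ x in U, f k x * fderiv ℝ ψ x (F x)) atTop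
      (𝓝 (∫ x in U, fderiv ℝ ψ x (φ x • F x))) := by
    refine tendsto_integral_of_dominated_convergence (fun x => ‖φ‖ * (C' * ‖F x‖))
      (fun k => (H.contDiff k).continuous.aestronglyMeasurable.mul
        (hψ.aestronglyMeasurable_fderiv hF.1)) ((hF.norm.const_mul _).const_mul _)
      (fun k => Eventually.of_forall fun x => ?_) ?_
    · rw [norm_mul]
      exact mul_le_mul (H.abs_le k x) (hC' x _) (norm_nonneg _) (norm_nonneg _)
    · filter_upwards [H.ae_eq, ae_restrict_mem hUm] with x hx hxU
      rw [map_smul, smul_eq_mul, ← hx]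
      exact (H.tendsto x hxU).mul_const _
  -- Since m may be singular to Lebesgue measure, a.e. convergence of f k would not do; convergence
  -- at every point of U is used.
  have L2 : Tendsto (fun k => ∫ x, f k x * ψ x * h x ∂m) atTop
      (𝓝 (∫ x, ψ x * (U.indicator φt x * h x) ∂m)) := by
    refine tendsto_integral_of_dominated_convergence (fun x => ‖φ‖ * C * ‖h x‖)
      (fun k => ((H.contDiff k).continuous.aestronglyMeasurable.mul
        hψ.1.continuous.aestronglyMeasurable).mul hh.1) (hh.norm.const_mul _)
      (fun k => Eventually.of_forall fun x => ?_) (Eventually.of_forall fun x => ?_)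
    · rw [norm_mul, norm_mul]
      gcongr
      exacts [H.abs_le k x, hC x]
    · by_cases hx : x ∈ U
      · rw [indicator_of_mem hx, ← mul_assoc, mul_comm (ψ x)]
        exact ((H.tendsto x hx).mul_const _).mul_const _
      · have : ψ x = 0 := image_eq_zero_of_notMem_tsupport fun h => hx (hψ.2.2 h)
        simp [this]
  have L3 : Tendsto (fun k => ∫ x in U, ψ x * inner ℝ (g k x) (F x)) atTop
      (𝓝 (∫ x, ψ x * U.indicator (fun x => inner ℝ (G x) (F x)) x)) := by
    have e : ∫ x, ψ x * U.indicator (fun x => inner ℝ (G x) (F x)) x =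
        ∫ x in U, ψ x * inner ℝ (G x) (F x) := by
      rw [← integral_indicator hUm]
      congr 1
      ext x
      by_cases hx : x ∈ U <;> simp [hx]
    rw [e]
    refine tendsto_integral_of_dominated_convergence (fun x => C * (‖G‖ * ‖F x‖))
      (fun k => hψ.1.continuous.aestronglyMeasurable.mul
        ((H.continuous_grad k).aestronglyMeasurable.inner hF.1))
      ((hF.norm.const_mul _).const_mul _) (fun k => Eventually.of_forall fun x => ?_) ?_
    · rw [norm_mul]
      refine mul_le_mul (hC x) ((norm_inner_le_norm _ _).trans ?_) (norm_nonneg _)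
        ((abs_nonneg _).trans (hC x))
      exact mul_le_mul_of_nonneg_right (H.norm_grad_le k x) (norm_nonneg _)
    · filter_upwards [H.tendsto_grad] with x hx
      exact (hx.inner tendsto_const_nhds).const_mul _
  -- The divergence of F is tested with the smooth product f k · ψ. For large k the gradient of f k
  -- is g k on the compact support of ψ; elsewhere the factor ψ removes the term.
  have key : ∀ᶠ k in atTop, ∫ x in U, f k x * fderiv ℝ ψ x (F x) =
      -(∫ x, f k x * ψ x * h x ∂m + ∫ x in U, ψ x * inner ℝ (g k x) (F x)) := by
    filter_upwards [H.fderiv_eq _ hψ.2.2 hψ.2.1] with k hk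
    have htest : IsTest U (fun x => f k x * ψ x) :=
      ⟨(H.contDiff k).mul hψ.1, hψ.2.1.mul_left, (tsupport_mul_subset_right).trans hψ.2.2⟩
    obtain ⟨D, hD⟩ := htest.exists_abs_le
    have h1 := hdiv.2 _ htest
    rw [integral_withDensityᵥ hh htest.1.continuous.measurable hD] at h1
    have h2 : ∀ x, fderiv ℝ (fun x => f k x * ψ x) x (F x) =
        f k x * fderiv ℝ ψ x (F x) + ψ x * inner ℝ (g k x) (F x) := by
      intro x
      rw [fderiv_fun_mul ((H.contDiff k).differentiable (by simp) x)
        (hψ.1.differentiable (by simp) x)]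
      simp only [_root_.add_apply, _root_.smul_apply, smul_eq_mul]
      by_cases hx : x ∈ tsupport ψ
      · rw [hk x hx]
      · rw [image_eq_zero_of_notMem_tsupport hx, zero_mul, zero_mul]
    have hFk : Integrable (fun x => f k x * fderiv ℝ ψ x (F x)) (volume.restrict U) :=
      (hψ.integrable_fderiv hF).bdd_mul (c := ‖φ‖) (H.contDiff k).continuous.aestronglyMeasurable
        (Eventually.of_forall (H.abs_le k))
    have hGk : Integrable (fun x => inner ℝ (g k x) (F x)) (volume.restrict U) := by
      refine (hF.norm.const_mul ‖G‖).mono'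
        ((H.continuous_grad k).aestronglyMeasurable.inner hF.1) (Eventually.of_forall fun x => ?_)
      exact (norm_inner_le_norm _ _).trans
        (mul_le_mul_of_nonneg_right (H.norm_grad_le k x) (norm_nonneg _))
    have hGk' : Integrable (fun x => ψ x * inner ℝ (g k x) (F x)) (volume.restrict U) :=
      hGk.bdd_mul (c := C) hψ.1.continuous.aestronglyMeasurable (Eventually.of_forall hC)
    simp only [h2] at h1
    rw [integral_add hFk hGk'] at h1
    linarith
  exact tendsto_nhds_unique L1 ((tendsto_congr' key).2 (L2.add L3).neg)

end Divergence

/-! ### The functional φ ↦ div(φF)(Ω) and its bound near the boundary -/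

section DivergenceFunctional

variable {n : ℕ} {U Ω : Set (Euc n)} {F : Euc n → Euc n}

lemma isWeakGrad_gradLinf (φ : W1inf U) : IsWeakGrad U (funLinf U φ) (gradLinf U φ) := φ.2

lemma exists_isDivMeasure_smul (hU : IsOpen U) (hF : MemDM1 U F) (φ : W1inf U) :
    ∃ ν, IsDivMeasure U (fun x => funRep φ x • F x) ν := by
  obtain ⟨hFi, ν, hν⟩ := hF
  obtain ⟨m, h, hh, rfl⟩ := exists_eq_withDensityᵥ ν
  obtain ⟨φt, f, g, H⟩ := exists_isSmoothApprox hU (isWeakGrad_gradLinf φ)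
  exact ⟨_, H.isDivMeasure hU hFi hh hν⟩

lemma memDM1_smul (hU : IsOpen U) (hF : MemDM1 U F) (φ : W1inf U) :
    MemDM1 U (fun x => funRep φ x • F x) :=
  ⟨integrableOn_smul_Linf hF.1 (funLinf U φ), exists_isDivMeasure_smul hU hF φ⟩

lemma funRep_add (φ χ : W1inf U) :
    funRep (φ + χ) =ᵐ[volume.restrict U] fun x => funRep φ x + funRep χ x := by
  unfold funRep
  rw [map_add]
  exact Lp.coeFn_add _ _

lemma funRep_smul (c : ℝ) (φ : W1inf U) :
    funRep (c • φ) =ᵐ[volume.restrict U] fun x => c * funRep φ x := by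
  unfold funRep
  rw [map_smul]
  exact Lp.coeFn_smul _ _

/-- The linear functional `φ ↦ div (φ F) (Ω)` on `W^{1,∞}(U)`. -/
def divFunctional (hU : IsOpen U) (hF : MemDM1 U F) (Ω : Set (Euc n)) : W1inf U →ₗ[ℝ] ℝ where
  toFun φ := divMeasure U (fun x => funRep φ x • F x) Ω
  map_add' φ χ := by
    obtain ⟨ν₁, h1⟩ := exists_isDivMeasure_smul hU hF φ
    obtain ⟨ν₂, h2⟩ := exists_isDivMeasure_smul hU hF χ
    have h3 : IsDivMeasure U (fun x => funRep (φ + χ) x • F x) (ν₁ + ν₂) := by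
      refine (h1.add h2 (memDM1_smul hU hF φ).1 (memDM1_smul hU hF χ).1).congr ?_
      filter_upwards [funRep_add φ χ] with x hx
      rw [hx, add_smul]
    rw [divMeasure_eq hU h1, divMeasure_eq hU h2, divMeasure_eq hU h3, add_apply]
  map_smul' c φ := by
    obtain ⟨ν, h1⟩ := exists_isDivMeasure_smul hU hF φ
    have h2 : IsDivMeasure U (fun x => funRep (c • φ) x • F x) (c • ν) := by
      refine (h1.const_smul c).congr ?_
      filter_upwards [funRep_smul c φ] with x hx
      rw [hx, mul_smul]
    rw [divMeasure_eq hU h1, divMeasure_eq hU h2, smul_apply, RingHom.id_apply]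

/-- A test function that agrees with the indicator of `Ω` away from the boundary of `Ω`. -/
lemma exists_test_eq_indicator (hUb : Bornology.IsBounded U) (hΩU : Ω ⊆ U) {δ : ℝ} (hδ : 0 < δ) :
    ∃ η : Euc n → ℝ, IsTest U η ∧ (∀ x, |Ω.indicator 1 x - η x| ≤ 1) ∧
      (∀ x ∉ Metric.thickening δ (frontier Ω), Ω.indicator 1 x = η x) ∧
      ∀ x ∉ Metric.thickening δ (frontier Ω), fderiv ℝ η x = 0 := by
  classical
  set K := frontier Ω with hK
  -- χ equals 1 near K and 0 near the complement of the δ-neighbourhood. Having neighbourhoods, not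
  -- just the sets, gives smoothness of η at K and Dη = 0 off K_δ.
  obtain ⟨χ, h0, h1, h01⟩ := exists_contMDiffMap_zero_one_nhds_of_isClosed (n := (⊤ : ℕ∞))
    (modelWithCornersSelf ℝ (Euc n))
    (Metric.isOpen_thickening (δ := δ) (E := K)).isClosed_compl isClosed_frontier
    (disjoint_compl_left_iff_subset.2 (Metric.self_subset_thickening hδ K))
  rw [eventually_nhdsSet_iff_forall] at h0 h1
  have hχ : ContDiff ℝ ∞ χ := χ.contMDiff.contDiff
  -- The indicator jumps only on K, near which 1 − χ vanishes, so η is smooth.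
  set η : Euc n → ℝ := Ω.indicator fun x => 1 - χ x with hη
  have hcase : ∀ x, x ∈ K ∨ x ∈ interior Ω ∨ x ∈ (closure Ω)ᶜ := by
    intro x
    by_cases hx : x ∈ closure Ω
    · by_cases hx' : x ∈ interior Ω
      · exact Or.inr (Or.inl hx')
      · exact Or.inl ⟨hx, hx'⟩
    · exact Or.inr (Or.inr hx)
  have hin : ∀ x ∈ interior Ω, η =ᶠ[𝓝 x] fun x => 1 - χ x := fun x hx => by
    filter_upwards [isOpen_interior.mem_nhds hx] with y hy
    rw [hη, indicator_of_mem (interior_subset hy)]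
  have hout : ∀ x ∈ (closure Ω)ᶜ, η =ᶠ[𝓝 x] fun _ => 0 := fun x hx => by
    filter_upwards [isClosed_closure.isOpen_compl.mem_nhds hx] with y hy
    rw [hη, indicator_of_notMem fun h => hy (subset_closure h)]
  have hbd : ∀ x ∈ K, η =ᶠ[𝓝 x] fun _ => 0 := fun x hx => by
    filter_upwards [h1 x hx] with y hy
    by_cases hyΩ : y ∈ Ω <;> simp [hη, hyΩ, hy]
  have hsmooth : ContDiff ℝ ∞ η := by
    refine contDiff_iff_contDiffAt.2 fun x => ?_
    rcases hcase x with hx | hx | hx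
    · exact contDiffAt_const.congr_of_eventuallyEq (hbd x hx)
    · exact (contDiffAt_const.sub hχ.contDiffAt).congr_of_eventuallyEq (hin x hx)
    · exact contDiffAt_const.congr_of_eventuallyEq (hout x hx)
  have hsupp : tsupport η ⊆ interior Ω := by
    intro x hx
    rcases hcase x with h | h | h
    · exact absurd hx (notMem_tsupport_iff_eventuallyEq.2 (hbd x h))
    · exact h
    · exact absurd hx (notMem_tsupport_iff_eventuallyEq.2 (hout x h))
  have hΩc : IsCompact (closure Ω) := (hUb.subset hΩU).isCompact_closure
  refine ⟨η, ⟨hsmooth, hΩc.of_isClosed_subset (isClosed_tsupport _)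
    ((hsupp.trans interior_subset).trans subset_closure),
    (hsupp.trans interior_subset).trans hΩU⟩, fun x => ?_, fun x hx => ?_, fun x hx => ?_⟩
  · by_cases hx : x ∈ Ω
    · simp only [hη, indicator_of_mem hx, Pi.one_apply, sub_sub_cancel]
      exact abs_le.2 ⟨by linarith [(h01 x).1], (h01 x).2⟩
    · simp [hη, hx]
  · have hx0 : χ x = 0 := (h0 x hx).self_of_nhds
    by_cases hxΩ : x ∈ Ω <;> simp [hη, hxΩ, hx0]
  · have hxK : x ∉ K := fun h => hx (Metric.self_subset_thickening hδ K h)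
    rcases hcase x with h | h | h
    · exact absurd h hxK
    · have : η =ᶠ[𝓝 x] fun _ => 1 := by
        filter_upwards [hin x h, h0 x hx] with y h2 h3
        rw [h2, h3, sub_zero]
      rw [this.fderiv_eq, fderiv_fun_const, Pi.zero_apply]
    · rw [(hout x h).fderiv_eq, fderiv_fun_const, Pi.zero_apply]

/-- The set where the bound fails is open and null, hence empty. The bound is needed at every point
because div F may charge Lebesgue null sets. -/
lemma abs_le_of_ae_restrict {V : Set (Euc n)} (hV : IsOpen V) {φ : Euc n → ℝ}
    (hφ : ContinuousOn φ V) {a : ℝ} (h : ∀ᵐ x ∂(volume.restrict V), |φ x| ≤ a) :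
    ∀ x ∈ V, |φ x| ≤ a := by
  have hopen : IsOpen (V ∩ (fun x => |φ x|) ⁻¹' Ioi a) :=
    hφ.abs.isOpen_inter_preimage hV isOpen_Ioi
  have hnull : volume (V ∩ (fun x => |φ x|) ⁻¹' Ioi a) = 0 := by
    rw [ae_restrict_iff' hV.measurableSet, ae_iff] at h
    refine measure_mono_null (fun x hx => ?_) h
    simpa using hx
  have hempty := (hopen.measure_eq_zero_iff volume).1 hnull
  intro x hx
  by_contra hxa
  have : x ∈ V ∩ (fun x => |φ x|) ⁻¹' Ioi a := ⟨hx, not_le.1 hxa⟩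
  rw [hempty] at this
  exact this

/-- `div (φ F) (Ω)` is controlled by `φ` and `Dφ` near the boundary of `Ω`. -/
theorem exists_divMeasure_bound (hU : IsOpen U) (hUb : Bornology.IsBounded U)
    (hΩ : MeasurableSet Ω) (hΩU : Ω ⊆ U) (hF : MemDM1 U F) {δ : ℝ} (hδ : 0 < δ) :
    ∃ C, 0 ≤ C ∧ ∀ (φ : Linf U ℝ) (G : Linf U (Euc n)) (a b : ℝ), IsWeakGrad U φ G →
      0 ≤ a → 0 ≤ b →
      (∀ᵐ x ∂(volume.restrict (Metric.thickening δ (frontier Ω) ∩ U)), |φ x| ≤ a) →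
      (∀ᵐ x ∂(volume.restrict (Metric.thickening δ (frontier Ω) ∩ U)), ‖G x‖ ≤ b) →
      |divMeasure U (fun x => φ x • F x) Ω| ≤ C * (a + b) := by
  set N := Metric.thickening δ (frontier Ω) with hN
  have hNo : IsOpen N := Metric.isOpen_thickening
  have hUm := hU.measurableSet
  obtain ⟨η, hη, hη1, hηN, hηd⟩ := exists_test_eq_indicator hUb hΩU hδ
  obtain ⟨D, hD0, hD⟩ := hη.exists_fderiv_le
  obtain ⟨B, hB⟩ := hη.exists_abs_le
  obtain ⟨hFi, ν, hν⟩ := hF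
  obtain ⟨m, h, hh, rfl⟩ := exists_eq_withDensityᵥ ν
  set IF := ∫ x in U, ‖F x‖ with hIF
  set Ih := ∫ x, ‖h x‖ ∂m with hIh
  have hIF0 : 0 ≤ IF := integral_nonneg fun _ => norm_nonneg _
  have hIh0 : 0 ≤ Ih := integral_nonneg fun _ => norm_nonneg _
  -- The summands belong to φ̃ div F, to Dφ · F and to φ F · Dη, with D a bound for Dη.
  refine ⟨Ih + IF + D * IF, by positivity, fun φ G a b hG ha hb hφa hφb => ?_⟩
  obtain ⟨φt, f, g, H⟩ := exists_isSmoothApprox hU hG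
  have hdiv := H.isDivMeasure hU hFi hh hν
  have hle : (volume : Measure (Euc n)).restrict (N ∩ U) ≤ volume.restrict U :=
    Measure.restrict_mono_set _ inter_subset_right
  have hφt : ∀ x ∈ N ∩ U, |φt x| ≤ a := by
    refine abs_le_of_ae_restrict (hNo.inter hU) (H.continuousOn.mono inter_subset_right) ?_
    filter_upwards [ae_mono hle H.ae_eq, hφa] with x h1 h2
    rw [h1]
    exact h2
  set dA : Euc n → ℝ := fun x => U.indicator φt x * h x with hdA
  set dB : Euc n → ℝ := U.indicator fun x => inner ℝ (G x) (F x) with hdB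
  have hA : Integrable dA m := H.integrable_mul hUm hh
  have hBi : Integrable dB := (integrable_indicator_iff hUm).2 (integrableOn_inner_Linf hFi _)
  have htest := hdiv.2 η hη
  have hηm : Measurable η := hη.1.continuous.measurable
  rw [VectorMeasure.integral_add_vectorMeasure (signedMeasure_integrable _ hηm hB)
    (signedMeasure_integrable _ hηm hB), integral_withDensityᵥ hA hηm hB,
    integral_withDensityᵥ hBi hηm hB] at htest
  have hval : divMeasure U (fun x => φ x • F x) Ω = ∫ x in Ω, dA x ∂m + ∫ x in Ω, dB x := by
    rw [divMeasure_eq hU hdiv, add_apply, withDensityᵥ_apply hA hΩ,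
      withDensityᵥ_apply hBi hΩ]
  have hsub : ∀ {μ : Measure (Euc n)} {d : Euc n → ℝ}, Integrable d μ →
      ∫ x in Ω, d x ∂μ - ∫ x, η x * d x ∂μ = ∫ x, (Ω.indicator 1 x - η x) * d x ∂μ := by
    intro μ d hd
    rw [← integral_indicator hΩ, ← integral_sub (hd.indicator hΩ)
      (hd.bdd_mul (c := B) hηm.aestronglyMeasurable (Eventually.of_forall hB))]
    congr 1
    ext x
    by_cases hx : x ∈ Ω <;> simp [hx, sub_mul]
  -- Subtracting the identity tested with η localizes the value: each integrand now vanishes off N ∩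
  -- U.
  have hT : divMeasure U (fun x => φ x • F x) Ω = (∫ x, (Ω.indicator 1 x - η x) * dA x ∂m) +
      (∫ x, (Ω.indicator 1 x - η x) * dB x) -
      ∫ x in U, fderiv ℝ η x (φ x • F x) := by
    rw [← hsub hA, ← hsub hBi, hval]
    linarith
  have b1 : |∫ x, (Ω.indicator 1 x - η x) * dA x ∂m| ≤ a * Ih := by
    rw [hIh, ← integral_const_mul, ← Real.norm_eq_abs]
    refine norm_integral_le_of_norm_le (hh.norm.const_mul a) (Eventually.of_forall fun x => ?_)
    rw [hdA, ← mul_assoc, norm_mul]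
    refine mul_le_mul_of_nonneg_right ?_ (norm_nonneg _)
    by_cases hxU : x ∈ U
    · by_cases hxN : x ∈ N
      · rw [norm_mul, indicator_of_mem hxU]
        calc _ ≤ 1 * a := mul_le_mul (hη1 x) (hφt x ⟨hxN, hxU⟩) (abs_nonneg _) zero_le_one
          _ = a := one_mul a
      · rw [hηN x hxN, sub_self, zero_mul, norm_zero]
        exact ha
    · rw [indicator_of_notMem hxU, mul_zero, norm_zero]
      exact ha
  have b2 : |∫ x, (Ω.indicator 1 x - η x) * dB x| ≤ b * IF := by
    rw [hIF, ← integral_const_mul, ← integral_indicator hUm, ← Real.norm_eq_abs]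
    refine norm_integral_le_of_norm_le
      ((integrable_indicator_iff hUm).2 (hFi.norm.const_mul b)) ?_
    have := (ae_restrict_iff' (hNo.inter hU).measurableSet).1 hφb
    filter_upwards [this] with x hx
    by_cases hxU : x ∈ U
    · rw [hdB, indicator_of_mem hxU, indicator_of_mem hxU]
      by_cases hxN : x ∈ N
      · rw [norm_mul]
        calc _ ≤ 1 * (b * ‖F x‖) := by
              refine mul_le_mul (hη1 x) ?_ (norm_nonneg _) zero_le_one
              exact (norm_inner_le_norm _ _).trans
                (mul_le_mul_of_nonneg_right (hx ⟨hxN, hxU⟩) (norm_nonneg _))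
          _ = _ := one_mul _
      · rw [hηN x hxN, sub_self, zero_mul, norm_zero]
        positivity
    · rw [hdB, indicator_of_notMem hxU, indicator_of_notMem hxU, mul_zero, norm_zero]
  have b3 : |∫ x in U, fderiv ℝ η x (φ x • F x)| ≤ a * D * IF := by
    rw [hIF, ← integral_const_mul, ← Real.norm_eq_abs]
    refine norm_integral_le_of_norm_le (hFi.norm.const_mul (a * D)) ?_
    filter_upwards [H.ae_eq, ae_restrict_mem hUm] with x hx hxU
    rw [← hx, map_smul, smul_eq_mul, norm_mul, mul_assoc]
    by_cases hxN : x ∈ N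
    · exact mul_le_mul (hφt x ⟨hxN, hxU⟩) (hD x _) (norm_nonneg _) ha
    · rw [hηd x hxN, zero_apply, norm_zero, mul_zero]
      positivity
  rw [hT]
  calc _ ≤ a * Ih + b * IF + a * D * IF :=
        (abs_sub _ _).trans (add_le_add ((abs_add_le _ _).trans (add_le_add b1 b2)) b3)
    _ ≤ _ := by
        nlinarith [mul_nonneg ha hIF0, mul_nonneg hb hIh0, mul_nonneg hb (mul_nonneg hD0 hIF0)]

lemma exists_divFunctional_bound (hU : IsOpen U) (hUb : Bornology.IsBounded U)
    (hΩ : MeasurableSet Ω) (hΩU : Ω ⊆ U) (hF : MemDM1 U F) {δ : ℝ} (hδ : 0 < δ) :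
    ∃ C, 0 ≤ C ∧ ∀ (φ : W1inf U) (a b : ℝ), 0 ≤ a → 0 ≤ b →
      (∀ᵐ x ∂(volume.restrict (Metric.thickening δ (frontier Ω) ∩ U)), |funLinf U φ x| ≤ a) →
      (∀ᵐ x ∂(volume.restrict (Metric.thickening δ (frontier Ω) ∩ U)), ‖gradLinf U φ x‖ ≤ b) →
      |divFunctional hU hF Ω φ| ≤ C * (a + b) := by
  obtain ⟨C, hC0, hC⟩ := exists_divMeasure_bound hU hUb hΩ hΩU hF hδ
  exact ⟨C, hC0, fun φ a b => hC (funLinf U φ) (gradLinf U φ) a b (isWeakGrad_gradLinf φ)⟩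

end DivergenceFunctional

/-! ### Restriction from U to a smaller set -/

section Restriction

variable {n : ℕ} {U V : Set (Euc n)}

lemma restrict_le_of_subset (hVU : V ⊆ U) :
    (volume : Measure (Euc n)).restrict V ≤ volume.restrict U :=
  Measure.restrict_mono_set _ hVU

/-- The restriction map `L^∞(U) → L^∞(V)` for `V ⊆ U`. -/
def restrictLinf {G : Type*} [NormedAddCommGroup G] [NormedSpace ℝ G] (hVU : V ⊆ U) :
    Linf U G →ₗ[ℝ] Linf V G where
  toFun f := ((Lp.memLp f).mono_measure (restrict_le_of_subset hVU)).toLp f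
  map_add' f g := by
    rw [← MemLp.toLp_add]
    exact MemLp.toLp_congr _ _ (ae_mono (restrict_le_of_subset hVU) (Lp.coeFn_add f g))
  map_smul' c f := by
    rw [RingHom.id_apply, ← MemLp.toLp_const_smul]
    exact MemLp.toLp_congr _ _ (ae_mono (restrict_le_of_subset hVU) (Lp.coeFn_smul c f))

lemma coeFn_restrictLinf {G : Type*} [NormedAddCommGroup G] [NormedSpace ℝ G] (hVU : V ⊆ U)
    (f : Linf U G) : restrictLinf hVU f =ᵐ[volume.restrict V] f :=
  MemLp.coeFn_toLp ((Lp.memLp f).mono_measure (restrict_le_of_subset hVU))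

lemma IsWeakGrad.restrict (hU : MeasurableSet U) (hVU : V ⊆ U) {φ : Linf U ℝ}
    {G : Linf U (Euc n)} (h : IsWeakGrad U φ G) :
    IsWeakGrad V (restrictLinf hVU φ) (restrictLinf hVU G) := by
  intro ψ hψ i
  have h1 := h ψ ⟨hψ.1, hψ.2.1, hψ.2.2.trans hVU⟩ i
  rw [setIntegral_eq_of_subset_of_forall_sdiff_eq_zero hU hVU,
    setIntegral_eq_of_subset_of_forall_sdiff_eq_zero hU hVU] at h1
  · rw [integral_congr_ae (g := fun x => φ x * fderiv ℝ ψ x (EuclideanSpace.single i 1)),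
      integral_congr_ae (f := fun x => restrictLinf hVU G x i * ψ x) (g := fun x => G x i * ψ x)]
    · exact h1
    · filter_upwards [coeFn_restrictLinf hVU G] with x hx
      rw [hx]
    · filter_upwards [coeFn_restrictLinf hVU φ] with x hx
      rw [hx]
  · intro x hx
    rw [image_eq_zero_of_notMem_tsupport (fun h => hx.2 (hψ.2.2 h)), mul_zero]
  · intro x hx
    have : fderiv ℝ ψ x = 0 :=
      image_eq_zero_of_notMem_tsupport fun h => hx.2 (hψ.2.2 (tsupport_fderiv_subset ℝ h))
    rw [this, zero_apply, mul_zero]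

lemma exists_restrict_W1inf (hU : MeasurableSet U) (hVU : V ⊆ U) (φ : W1inf U) :
    ∃ χ : W1inf V, funLinf V χ = restrictLinf hVU (funLinf U φ) ∧
      gradLinf V χ = restrictLinf hVU (gradLinf U φ) :=
  ⟨⟨(restrictLinf hVU (funLinf U φ), restrictLinf hVU (gradLinf U φ)),
    (isWeakGrad_gradLinf φ).restrict hU hVU⟩, rfl, rfl⟩

end Restriction

/-! ### Hahn–Banach extension and bounds from continuous inverses -/

section HahnBanach

/-- The bound forces T to vanish on the kernel of ι, so T descends to the range of ι and Hahn–Banach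
applies there. -/
lemma exists_functional_of_seminorm_bound {W X : Type*} [AddCommGroup W] [Module ℝ W]
    [AddCommGroup X] [Module ℝ X] (T : W →ₗ[ℝ] ℝ) (ι : W →ₗ[ℝ] X) (p : Seminorm ℝ X)
    (h : ∀ w, |T w| ≤ p (ι w)) :
    ∃ Λ : X →ₗ[ℝ] ℝ, (∀ w, Λ (ι w) = T w) ∧ ∀ x, |Λ x| ≤ p x := by
  -- A linear choice of preimages realizes the descended functional as T ∘ s; by the bound, T does
  -- not see which preimage is taken.
  obtain ⟨s, hs⟩ := ι.rangeRestrict.exists_rightInverse_of_surjective ι.range_rangeRestrict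
  have hs' : ∀ y : ι.range, ι (s y) = y := fun y => by
    have := congrArg Subtype.val (LinearMap.congr_fun hs y)
    simpa using this
  obtain ⟨Λ, hΛ, hle⟩ := exists_extension_of_le_sublinear ⟨ι.range, T.comp s⟩ p
    (fun c hc x => by rw [map_smul_eq_mul, Real.norm_of_nonneg hc.le]) (map_add_le_add p)
    (fun x => (le_abs_self _).trans ((h _).trans_eq (by rw [hs'])))
  refine ⟨Λ, fun w => ?_, fun x => abs_le.2 ⟨?_, hle x⟩⟩
  · have h1 := hΛ ⟨ι w, LinearMap.mem_range_self ι w⟩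
    have h2 : T (s ⟨ι w, LinearMap.mem_range_self ι w⟩) = T w := by
      rw [← sub_eq_zero, ← map_sub, ← abs_nonpos_iff]
      refine (h _).trans_eq ?_
      rw [map_sub, hs', sub_self, map_zero]
    exact h1.trans h2
  · have := hle (-x)
    rw [map_neg, map_neg_eq_map] at this
    linarith

/-- A left inverse of a linear map is automatically linear on the range, so continuity of g amounts
to boundedness. -/
lemma exists_bound_of_continuous_leftInverse {E Y : Type*} [SeminormedAddCommGroup E]
    [NormedSpace ℝ E] [SeminormedAddCommGroup Y] [NormedSpace ℝ Y] (ι : E →ₗ[ℝ] Y)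
    {g : LinearMap.range ι → E} (hg : Continuous g) (hgι : ∀ φ, g (ι.rangeRestrict φ) = φ) :
    ∃ C, 0 ≤ C ∧ ∀ φ, ‖φ‖ ≤ C * ‖ι φ‖ := by
  let gl : LinearMap.range ι →ₗ[ℝ] E :=
    { toFun := g
      map_add' := fun x y => by
        obtain ⟨a, rfl⟩ := ι.surjective_rangeRestrict x
        obtain ⟨b, rfl⟩ := ι.surjective_rangeRestrict y
        rw [← map_add, hgι, hgι, hgι]
      map_smul' := fun c x => by
        obtain ⟨a, rfl⟩ := ι.surjective_rangeRestrict x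
        rw [← map_smul, hgι, hgι, RingHom.id_apply] }
  obtain ⟨C, hC, hb⟩ := (⟨gl, hg⟩ : LinearMap.range ι →L[ℝ] E).bound
  refine ⟨C, hC.le, fun φ => ?_⟩
  have h1 := hb (ι.rangeRestrict φ)
  rwa [show (⟨gl, hg⟩ : LinearMap.range ι →L[ℝ] E) (ι.rangeRestrict φ) = φ from hgι φ] at h1

lemma HasContInverse.exists_bound {n : ℕ} {V : Set (Euc n)} {X₀ : Type*}
    [SeminormedAddCommGroup X₀] [NormedSpace ℝ X₀] {ι₀ : W1inf V →ₗ[ℝ] X₀}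
    (h : HasContInverse ι₀) : ∃ C, 0 ≤ C ∧ ∀ φ, ‖φ‖ ≤ C * (‖ι₀ φ‖ + ‖gradLinf V φ‖) := by
  obtain ⟨g, hg, hgι⟩ := h
  obtain ⟨C, hC, hb⟩ := exists_bound_of_continuous_leftInverse (ι₀.prod (gradLinf V)) hg hgι
  refine ⟨C, hC, fun φ => (hb φ).trans (mul_le_mul_of_nonneg_left ?_ hC)⟩
  change ‖(ι₀ φ, gradLinf V φ)‖ ≤ _
  rw [Prod.norm_mk]
  exact max_le (le_add_of_nonneg_right (norm_nonneg _)) (le_add_of_nonneg_left (norm_nonneg _))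

lemma norm_funLinf_le {n : ℕ} {V : Set (Euc n)} (φ : W1inf V) : ‖funLinf V φ‖ ≤ ‖φ‖ :=
  norm_fst_le φ.1

lemma CaseL.exists_bound {n : ℕ} {U K : Set (Euc n)} {δ : ℝ} (h : CaseL U K δ) :
    ∃ C, 0 ≤ C ∧ ∀ φ : W1inf (Metric.thickening δ K ∩ U), ‖funLinf _ φ‖ ≤
      C * (‖(nullNear K (Metric.thickening δ K ∩ U)).mkQ (funLinf _ φ)‖ + ‖gradLinf _ φ‖) := by
  obtain ⟨C, hC, hb⟩ := HasContInverse.exists_bound h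
  exact ⟨C, hC, fun φ => (norm_funLinf_le φ).trans (hb φ)⟩

end HahnBanach

/-! ### Boundary values and the quotient L^∞_K(V) -/

section NearBoundary

variable {n : ℕ} {U K V : Set (Euc n)}

/-- Continuous functions that vanish on a compact set `K` belong to `nullNear K V`. -/
lemma mem_nullNear_of_continuousOn (hK : IsCompact K) (hV : MeasurableSet V) {f : Linf V ℝ}
    {g : Euc n → ℝ} (hg : ContinuousOn g (V ∪ K)) (hfg : f =ᵐ[volume.restrict V] g)
    (h0 : ∀ x ∈ K, g x = 0) : f ∈ nullNear K V := by
  change Tendsto _ _ _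
  rw [ENNReal.tendsto_nhds_zero]
  intro ε hε
  obtain ⟨e, he, heε⟩ : ∃ e : ℝ, 0 < e ∧ ENNReal.ofReal e ≤ ε := by
    rcases eq_or_ne ε ∞ with rfl | hne
    · exact ⟨1, one_pos, le_top⟩
    · exact ⟨ε.toReal, ENNReal.toReal_pos hε.ne' hne, ENNReal.ofReal_toReal_le⟩
  have hx : ∀ x ∈ K, ∃ O : Set (Euc n), IsOpen O ∧ x ∈ O ∧ ∀ y ∈ O ∩ (V ∪ K), |g y| ≤ e := by
    intro x hx
    have h1 : ∀ᶠ y in 𝓝[V ∪ K] x, |g y| ≤ e := by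
      have := (hg x (Or.inr hx)).abs.tendsto
      rw [h0 x hx, abs_zero] at this
      exact this.eventually (ge_mem_nhds he)
    obtain ⟨O, hO, hxO, hOs⟩ := mem_nhdsWithin.1 h1
    exact ⟨O, hO, hxO, fun y hy => hOs hy⟩
  choose! O hO hxO hOb using hx
  -- Compactness of K turns the pointwise neighbourhoods into one uniform thickening.
  obtain ⟨r, hr, hrO⟩ := hK.exists_thickening_subset_open (t := ⋃ x ∈ K, O x)
    (isOpen_biUnion hO) (fun x hx => mem_biUnion hx (hxO x hx))
  filter_upwards [Ioc_mem_nhdsGT hr] with η hη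
  refine le_trans ?_ heε
  rw [eLpNorm_exponent_top]
  refine eLpNormEssSup_le_of_ae_bound ?_
  have hle := restrict_le_of_subset (inter_subset_right (s := Metric.thickening η K) (t := V))
  filter_upwards [ae_mono hle hfg,
    ae_restrict_mem ((Metric.isOpen_thickening (δ := η) (E := K)).measurableSet.inter hV)]
    with x h1 h2
  obtain ⟨y, hy, hxy⟩ := mem_iUnion₂.1 (hrO (Metric.thickening_mono hη.2 K h2.1))
  rw [h1]
  exact hOb y hy x ⟨hxy, Or.inl h2.2⟩

/-- The boundary values of a continuous function are controlled by its norm in `L^∞_K(V)`. -/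
lemma abs_le_norm_mkQ (hV : IsOpen V) {x : Euc n} (hxK : x ∈ K) (hxV : x ∈ closure V)
    {f : Linf V ℝ} {g : Euc n → ℝ} (hg : ContinuousOn g (V ∪ K))
    (hfg : f =ᵐ[volume.restrict V] g) : |g x| ≤ ‖(nullNear K V).mkQ f‖ := by
  refine le_of_forall_pos_le_add fun ε hε => ?_
  have hε3 : 0 < ε / 3 := by positivity
  -- The representative q almost attains the quotient norm, and q − f is small near K. Comparing
  -- g(x), g(y) = f(y) and q(y) at some y near x in V costs ε/3 three times, the last being ‖q‖
  -- against the quotient norm.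
  obtain ⟨q, hq, hqn⟩ := Submodule.Quotient.norm_mk_lt ((nullNear K V).mkQ f) hε3
  have hn : q - f ∈ nullNear K V := (Submodule.Quotient.eq _).1 hq
  have h1 : ∀ᶠ η in 𝓝[>] (0 : ℝ), eLpNorm (q - f : Linf V ℝ) ∞
      (volume.restrict (Metric.thickening η K ∩ V)) < ENNReal.ofReal (ε / 3) :=
    (show Tendsto _ _ _ from hn).eventually (gt_mem_nhds (by positivity))
  obtain ⟨η, hη, hη0⟩ := (h1.and self_mem_nhdsWithin).exists
  have h2 : ∀ᶠ y in 𝓝[V ∪ K] x, |g y - g x| < ε / 3 := by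
    have := (hg x (Or.inr hxK)).tendsto
    filter_upwards [this (Metric.ball_mem_nhds _ hε3)] with y hy
    exact hy
  obtain ⟨O, hO, hxO, hOs⟩ := mem_nhdsWithin.1 h2
  have hopen : IsOpen (O ∩ Metric.thickening η K ∩ V) :=
    (hO.inter Metric.isOpen_thickening).inter hV
  have hne : (O ∩ Metric.thickening η K ∩ V).Nonempty :=
    mem_closure_iff.1 hxV _ (hO.inter Metric.isOpen_thickening)
      ⟨hxO, Metric.self_subset_thickening hη0 K hxK⟩
  have hpos : 0 < volume (O ∩ Metric.thickening η K ∩ V) := hopen.measure_pos volume hne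
  have hle1 := restrict_le_of_subset (n := n) (U := V) (V := O ∩ Metric.thickening η K ∩ V)
    inter_subset_right
  have hle2 := restrict_le_of_subset (n := n) (U := Metric.thickening η K ∩ V)
    (V := O ∩ Metric.thickening η K ∩ V) (fun y hy => ⟨hy.1.2, hy.2⟩)
  have hae : ∀ᵐ y ∂(volume.restrict (O ∩ Metric.thickening η K ∩ V)),
      |g x| ≤ ‖(nullNear K V).mkQ f‖ + ε := by
    filter_upwards [ae_mono hle1 hfg, ae_mono hle1 (ae_norm_le_Linf q),
      ae_mono hle1 (Lp.coeFn_sub q f),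
      ae_mono hle2 (enorm_ae_le_eLpNormEssSup (q - f : Linf V ℝ)
        (volume.restrict (Metric.thickening η K ∩ V))),
      ae_restrict_mem hopen.measurableSet] with y y1 y2 y3 y4 y5
    rw [← eLpNorm_exponent_top] at y4
    have y6 := y4.trans_lt hη
    rw [y3, Pi.sub_apply, ← ofReal_norm, ENNReal.ofReal_lt_ofReal_iff hε3, Real.norm_eq_abs,
      y1] at y6
    have y7 : |g y - g x| < ε / 3 := hOs ⟨y5.1.1, Or.inl y5.2⟩
    rw [Real.norm_eq_abs] at y2
    have := abs_sub_abs_le_abs_sub (g x) (g y)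
    have := abs_sub_abs_le_abs_sub (g y) (q y)
    rw [abs_sub_comm] at y6 y7
    linarith
  have : (ae (volume.restrict (O ∩ Metric.thickening η K ∩ V))).NeBot := by
    rw [ae_neBot, ← Measure.measure_univ_ne_zero, Measure.restrict_apply_univ]
    exact hpos.ne'
  exact hae.exists.choose_spec

/-- As K lies in the closure of V, the maximum over K is at most the quotient norm. Case (C) thus
yields the same estimate as case (L), and both are treated together from here on. -/
lemma CaseC.exists_bound {δ : ℝ} (hU : IsOpen U) (hK : IsCompact K)
    (hKU : K ⊆ closure (Metric.thickening δ K ∩ U)) (h : CaseC U K δ) :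
    ∃ C, 0 ≤ C ∧ ∀ φ : W1inf (Metric.thickening δ K ∩ U), ‖funLinf _ φ‖ ≤
      C * (‖(nullNear K (Metric.thickening δ K ∩ U)).mkQ (funLinf _ φ)‖ + ‖gradLinf _ φ‖) := by
  obtain ⟨ι₀, hι, hinv⟩ := h
  have := isCompact_iff_compactSpace.1 hK
  obtain ⟨C, hC, hb⟩ := hinv.exists_bound
  refine ⟨C, hC, fun φ => (norm_funLinf_le φ).trans ((hb φ).trans ?_)⟩
  refine mul_le_mul_of_nonneg_left (add_le_add ?_ le_rfl) hC
  obtain ⟨g, ⟨hg, hgφ⟩, hgι⟩ := hι φ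
  refine (ContinuousMap.norm_le _ (norm_nonneg _)).2 fun x => ?_
  rw [hgι x, Real.norm_eq_abs]
  exact abs_le_norm_mkQ (Metric.isOpen_thickening.inter hU) x.2 (hKU x.2) hg hgφ.symm

end NearBoundary

/-! ### Riesz representation of bounded functionals on C(X) -/

section SignedRiesz

open scoped NNReal CompactlySupported

variable {X : Type*} [TopologicalSpace X]

/-- A continuous function with values in `ℝ≥0`, as a real-valued function. -/
def toRealMap (f : C_c(X, ℝ≥0)) : C(X, ℝ) := ⟨fun x => f x, by fun_prop⟩

lemma toRealMap_nonneg (f : C_c(X, ℝ≥0)) : 0 ≤ toRealMap f := fun x => (f x).2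

lemma toRealMap_add (f g : C_c(X, ℝ≥0)) : toRealMap (f + g) = toRealMap f + toRealMap g := by
  ext x; simp [toRealMap]

lemma toRealMap_smul (c : ℝ≥0) (f : C_c(X, ℝ≥0)) :
    toRealMap (c • f) = (c : ℝ) • toRealMap f := by
  ext x; simp [toRealMap]

variable [CompactSpace X]

/-- The positive part of a functional on `C(X)`, evaluated at nonnegative functions. -/
def posPartFunctional (ℓ : C(X, ℝ) →ₗ[ℝ] ℝ) (f : C(X, ℝ)) : ℝ :=
  sSup (ℓ '' Icc 0 f)

variable {ℓ : C(X, ℝ) →ₗ[ℝ] ℝ} {C : ℝ}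

lemma bddAbove_image_Icc (hC : 0 ≤ C) (hℓ : ∀ f, |ℓ f| ≤ C * ‖f‖) (f : C(X, ℝ)) :
    BddAbove (ℓ '' Icc 0 f) := by
  refine ⟨C * ‖f‖, ?_⟩
  rintro _ ⟨g, ⟨hg0, hgf⟩, rfl⟩
  refine (le_abs_self _).trans ((hℓ g).trans (mul_le_mul_of_nonneg_left ?_ hC))
  refine (ContinuousMap.norm_le _ (norm_nonneg _)).2 fun x => ?_
  rw [Real.norm_of_nonneg (show 0 ≤ g x from hg0 x)]
  exact (show g x ≤ f x from hgf x).trans ((le_abs_self _).trans (f.norm_coe_le_norm x))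

lemma posPartFunctional_nonneg (hC : 0 ≤ C) (hℓ : ∀ f, |ℓ f| ≤ C * ‖f‖) {f : C(X, ℝ)}
    (hf : 0 ≤ f) : 0 ≤ posPartFunctional ℓ f :=
  le_csSup (bddAbove_image_Icc hC hℓ f) ⟨0, ⟨le_rfl, hf⟩, map_zero ℓ⟩

lemma le_posPartFunctional (hC : 0 ≤ C) (hℓ : ∀ f, |ℓ f| ≤ C * ‖f‖) {f : C(X, ℝ)}
    (hf : 0 ≤ f) : ℓ f ≤ posPartFunctional ℓ f :=
  le_csSup (bddAbove_image_Icc hC hℓ f) ⟨f, ⟨hf, le_rfl⟩, rfl⟩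

/-- Riesz decomposition: if 0 ≤ k ≤ f + g, then k splits into k ⊓ f ≤ f and k − k ⊓ f ≤ g. -/
lemma posPartFunctional_add (hC : 0 ≤ C) (hℓ : ∀ f, |ℓ f| ≤ C * ‖f‖) {f g : C(X, ℝ)}
    (hf : 0 ≤ f) (hg : 0 ≤ g) :
    posPartFunctional ℓ (f + g) = posPartFunctional ℓ f + posPartFunctional ℓ g := by
  have hbd := bddAbove_image_Icc hC hℓ
  apply le_antisymm
  · refine csSup_le ⟨_, 0, ⟨le_rfl, add_nonneg hf hg⟩, rfl⟩ ?_
    rintro _ ⟨k, ⟨hk0, hk⟩, rfl⟩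
    have e : ℓ k = ℓ (k ⊓ f) + ℓ (k - k ⊓ f) := by rw [← map_add, add_sub_cancel]
    rw [e]
    refine add_le_add (le_csSup (hbd f) ⟨_, ⟨le_inf hk0 hf, inf_le_right⟩, rfl⟩)
      (le_csSup (hbd g) ⟨_, ⟨sub_nonneg.2 inf_le_left, ?_⟩, rfl⟩)
    intro x
    have h1 : k x ≤ f x + g x := hk x
    have h2 : 0 ≤ g x := hg x
    change k x - min (k x) (f x) ≤ g x
    rcases min_cases (k x) (f x) with h | h <;> linarith
  · rw [← le_sub_iff_add_le]
    refine csSup_le ⟨_, 0, ⟨le_rfl, hf⟩, rfl⟩ ?_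
    rintro _ ⟨a, ⟨ha0, ha⟩, rfl⟩
    rw [le_sub_comm]
    refine csSup_le ⟨_, 0, ⟨le_rfl, hg⟩, rfl⟩ ?_
    rintro _ ⟨b, ⟨hb0, hb⟩, rfl⟩
    rw [le_sub_iff_add_le', ← map_add]
    exact le_csSup (hbd _) ⟨_, ⟨add_nonneg ha0 hb0, add_le_add ha hb⟩, rfl⟩

/-- For c > 0 one inequality suffices: the other is the same inequality for c⁻¹ and c • f. -/
lemma posPartFunctional_smul {c : ℝ} (hc : 0 ≤ c) {f : C(X, ℝ)} (hf : 0 ≤ f)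
    (hC : 0 ≤ C) (hℓ : ∀ f, |ℓ f| ≤ C * ‖f‖) :
    posPartFunctional ℓ (c • f) = c * posPartFunctional ℓ f := by
  have key : ∀ {c : ℝ}, 0 < c → ∀ {f : C(X, ℝ)}, 0 ≤ f →
      c * posPartFunctional ℓ f ≤ posPartFunctional ℓ (c • f) := by
    intro c hc f hf
    rw [← le_div_iff₀' hc]
    refine csSup_le ⟨_, 0, ⟨le_rfl, hf⟩, rfl⟩ ?_
    rintro _ ⟨a, ⟨ha0, ha⟩, rfl⟩
    rw [le_div_iff₀' hc, ← smul_eq_mul, ← map_smul]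
    exact le_csSup (bddAbove_image_Icc hC hℓ _)
      ⟨_, ⟨smul_nonneg hc.le ha0, smul_le_smul_of_nonneg_left ha hc.le⟩, rfl⟩
  rcases hc.eq_or_lt with rfl | hc
  · rw [zero_smul, zero_mul, posPartFunctional, Icc_self, image_singleton, map_zero, csSup_singleton]
  · refine le_antisymm ?_ (key hc hf)
    have h := key (inv_pos.2 hc) (smul_nonneg hc.le hf)
    rw [inv_smul_smul₀ hc.ne'] at h
    rwa [← inv_mul_le_iff₀ hc]

/-- The **Riesz representation theorem** for bounded functionals on `C(X)`. -/
theorem exists_measures_of_functional [T2Space X] [MeasurableSpace X] [BorelSpace X]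
    (hC : 0 ≤ C) (hℓ : ∀ f, |ℓ f| ≤ C * ‖f‖) :
    ∃ (μ₁ μ₂ : Measure X), IsFiniteMeasure μ₁ ∧ IsFiniteMeasure μ₂ ∧
      ∀ f : C(X, ℝ), ℓ f = ∫ x, f x ∂μ₁ - ∫ x, f x ∂μ₂ := by
  -- Jordan decomposition ℓ = ℓ⁺ − (ℓ⁺ − ℓ): `Λ₁` is ℓ⁺ and `Λ₂` is ℓ⁺ − ℓ. Both are positive, so
  -- the Riesz theorem for positive functionals applies to each.
  let Λ₁ : C_c(X, ℝ≥0) →ₗ[ℝ≥0] ℝ≥0 :=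
    { toFun := fun f => ⟨posPartFunctional ℓ (toRealMap f),
        posPartFunctional_nonneg hC hℓ (toRealMap_nonneg f)⟩
      map_add' := fun f g => by
        refine NNReal.eq ?_
        change posPartFunctional ℓ (toRealMap (f + g)) =
          posPartFunctional ℓ (toRealMap f) + posPartFunctional ℓ (toRealMap g)
        rw [toRealMap_add]
        exact posPartFunctional_add hC hℓ (toRealMap_nonneg f) (toRealMap_nonneg g)
      map_smul' := fun c f => by
        refine NNReal.eq ?_
        change posPartFunctional ℓ (toRealMap (c • f)) = c * posPartFunctional ℓ (toRealMap f)
        rw [toRealMap_smul]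
        exact posPartFunctional_smul c.coe_nonneg (toRealMap_nonneg f) hC hℓ }
  let Λ₂ : C_c(X, ℝ≥0) →ₗ[ℝ≥0] ℝ≥0 :=
    { toFun := fun f => ⟨posPartFunctional ℓ (toRealMap f) - ℓ (toRealMap f),
        sub_nonneg.2 (le_posPartFunctional hC hℓ (toRealMap_nonneg f))⟩
      map_add' := fun f g => by
        refine NNReal.eq ?_
        change posPartFunctional ℓ (toRealMap (f + g)) - ℓ (toRealMap (f + g)) =
          (posPartFunctional ℓ (toRealMap f) - ℓ (toRealMap f)) +
            (posPartFunctional ℓ (toRealMap g) - ℓ (toRealMap g))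
        rw [toRealMap_add, map_add,
          posPartFunctional_add hC hℓ (toRealMap_nonneg f) (toRealMap_nonneg g)]
        ring
      map_smul' := fun c f => by
        refine NNReal.eq ?_
        change posPartFunctional ℓ (toRealMap (c • f)) - ℓ (toRealMap (c • f)) =
          c * (posPartFunctional ℓ (toRealMap f) - ℓ (toRealMap f))
        rw [toRealMap_smul, map_smul, smul_eq_mul,
          posPartFunctional_smul c.coe_nonneg (toRealMap_nonneg f) hC hℓ]
        ring }
  have hfin : ∀ Λ : C_c(X, ℝ≥0) →ₗ[ℝ≥0] ℝ≥0, IsFiniteMeasure (NNRealRMK.rieszMeasure Λ) :=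
    fun Λ => ⟨isCompact_univ.measure_lt_top⟩
  have hpos : ∀ f : C_c(X, ℝ≥0), ℓ (toRealMap f) =
      ∫ x, (f x : ℝ) ∂(NNRealRMK.rieszMeasure Λ₁) - ∫ x, (f x : ℝ) ∂(NNRealRMK.rieszMeasure Λ₂) := by
    intro f
    rw [NNRealRMK.integral_rieszMeasure, NNRealRMK.integral_rieszMeasure]
    change _ = posPartFunctional ℓ (toRealMap f) -
      (posPartFunctional ℓ (toRealMap f) - ℓ (toRealMap f))
    ring
  refine ⟨NNRealRMK.rieszMeasure Λ₁, NNRealRMK.rieszMeasure Λ₂, hfin _, hfin _, fun f => ?_⟩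
  have := hfin Λ₁
  have := hfin Λ₂
  let fp : C_c(X, ℝ≥0) := ⟨⟨fun x => (f x).toNNReal, by fun_prop⟩, HasCompactSupport.of_compactSpace _⟩
  let fn : C_c(X, ℝ≥0) := ⟨⟨fun x => (-f x).toNNReal, by fun_prop⟩, HasCompactSupport.of_compactSpace _⟩
  have hdec : ∀ x, f x = (fp x : ℝ) - (fn x : ℝ) := fun x => by
    change f x = ((f x).toNNReal : ℝ) - ((-f x).toNNReal : ℝ)
    rw [Real.coe_toNNReal', Real.coe_toNNReal']
    rcases le_total 0 (f x) with h | h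
    · rw [max_eq_left h, max_eq_right (by linarith), sub_zero]
    · rw [max_eq_right h, max_eq_left (by linarith)]; ring
  have hf : f = toRealMap fp - toRealMap fn := by
    ext x
    exact hdec x
  have hint : ∀ (μ : Measure X) [IsFiniteMeasure μ] (k : C_c(X, ℝ≥0)),
      Integrable (fun x => (k x : ℝ)) μ := fun μ _ k =>
    (toRealMap k).continuous.integrable_of_hasCompactSupport (HasCompactSupport.of_compactSpace _)
  have hi : ∀ (μ : Measure X) [IsFiniteMeasure μ],
      ∫ x, f x ∂μ = ∫ x, (fp x : ℝ) ∂μ - ∫ x, (fn x : ℝ) ∂μ := fun μ _ => by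
    rw [← integral_sub (hint μ fp) (hint μ fn)]
    exact integral_congr_ae (Eventually.of_forall hdec)
  rw [hi, hi]
  conv_lhs => rw [hf, map_sub, hpos, hpos]
  ring

end SignedRiesz

/-! ### The signed measure on the boundary -/

section BoundaryMeasure

variable {n : ℕ} {K V : Set (Euc n)}

/-- A bounded functional on `L^∞(V)` that vanishes on `nullNear K V` is represented by a signed
measure on `K` for functions that are continuous up to `K`. -/
theorem exists_signedMeasure_of_functional (hK : IsCompact K) (hV : MeasurableSet V)
    {ℓ : Linf V ℝ →ₗ[ℝ] ℝ} {C : ℝ} (hC : 0 ≤ C) (hℓ : ∀ f, |ℓ f| ≤ C * ‖f‖)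
    (h0 : ∀ f ∈ nullNear K V, ℓ f = 0) :
    ∃ σ : SignedMeasure (Euc n), σ.variation.support ⊆ K ∧
      ∀ (f : Linf V ℝ) (g : Euc n → ℝ), ContinuousOn g (V ∪ K) → f =ᵐ[volume.restrict V] g →
        ℓ f = ∫ᵛ x in K, g x ∂•σ := by
  have hcpt := isCompact_iff_compactSpace.1 hK
  -- Norm-preserving Tietze extension, so that the functional induced on C(K) keeps the bound C.
  have hext : ∀ h : C(K, ℝ), ∃ g : BoundedContinuousFunction (Euc n) ℝ,
      (∀ x, |g x| ≤ ‖h‖) ∧ ∀ x : K, g x = h x := by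
    intro h
    obtain ⟨g, hg1, hg2⟩ := BoundedContinuousFunction.exists_extension_norm_eq_of_isClosedEmbedding
      (BoundedContinuousFunction.mkOfCompact h) hK.isClosed.isClosedEmbedding_subtypeVal
    rw [BoundedContinuousFunction.norm_mkOfCompact] at hg1
    exact ⟨g, fun x => (g.norm_coe_le_norm x).trans_eq hg1, fun x => congrFun hg2 x⟩
  choose E hEb hEx using hext
  have hmem : ∀ h, MemLp (E h) ∞ (volume.restrict V) := fun h =>
    memLp_top_of_bound (E h).continuous.aestronglyMeasurable ‖h‖ (Eventually.of_forall (hEb h))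
  have hEc : ∀ h, (hmem h).toLp (E h) =ᵐ[volume.restrict V] E h := fun h => MemLp.coeFn_toLp _
  -- Two functions continuous up to K with equal values there differ by an element of `nullNear`,
  -- which ℓ kills. Hence the induced functional is linear although the extension `E` need not be.
  have huniq : ∀ (f : Linf V ℝ) (g : Euc n → ℝ) (h : C(K, ℝ)), ContinuousOn g (V ∪ K) →
      f =ᵐ[volume.restrict V] g → (∀ x : K, g x = h x) → ℓ f = ℓ ((hmem h).toLp (E h)) := by
    intro f g h hg hfg hgh
    rw [← sub_eq_zero, ← map_sub]
    refine h0 _ (mem_nullNear_of_continuousOn (g := fun x => g x - E h x) hK hV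
      (hg.sub (E h).continuous.continuousOn) ?_ fun x hx => ?_)
    · filter_upwards [hfg, hEc h, Lp.coeFn_sub f ((hmem h).toLp (E h))] with x h1 h2 h3
      rw [h3, Pi.sub_apply, h1, h2]
    · rw [hEx h ⟨x, hx⟩, hgh ⟨x, hx⟩, sub_self]
  let L : C(K, ℝ) →ₗ[ℝ] ℝ :=
    { toFun := fun h => ℓ ((hmem h).toLp (E h))
      map_add' := fun h k => by
        rw [← map_add]
        refine (huniq _ (fun x => E h x + E k x) (h + k)
          ((E h).continuous.add (E k).continuous).continuousOn ?_ fun x => ?_).symm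
        · filter_upwards [hEc h, hEc k, Lp.coeFn_add ((hmem h).toLp (E h)) ((hmem k).toLp (E k))]
            with x h1 h2 h3
          rw [h3, Pi.add_apply, h1, h2]
        · rw [hEx, hEx, ContinuousMap.add_apply]
      map_smul' := fun c h => by
        rw [RingHom.id_apply, ← map_smul]
        refine (huniq _ (fun x => c * E h x) (c • h)
          (continuous_const.mul (E h).continuous).continuousOn ?_ fun x => ?_).symm
        · filter_upwards [hEc h, Lp.coeFn_smul c ((hmem h).toLp (E h))] with x h1 h2
          rw [h2, Pi.smul_apply, h1, smul_eq_mul]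
        · rw [hEx, ContinuousMap.smul_apply, smul_eq_mul] }
  have hL : ∀ h, |L h| ≤ C * ‖h‖ := fun h => by
    refine (hℓ _).trans (mul_le_mul_of_nonneg_left (norm_Linf_le (norm_nonneg _) ?_) hC)
    filter_upwards [hEc h] with x hx
    rw [hx]
    exact hEb h x
  obtain ⟨μ₁, μ₂, hf1, hf2, hμ⟩ := exists_measures_of_functional hC hL
  have hnull : ∀ μ : Measure K, (μ.map Subtype.val) Kᶜ = 0 := fun μ => by
    rw [Measure.map_apply measurable_subtype_coe hK.measurableSet.compl]
    convert measure_empty (μ := μ)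
    ext x
    simp
  have hint : ∀ (μ : Measure K) [IsFiniteMeasure μ] (g : Euc n → ℝ), ContinuousOn g K →
      Integrable (K.indicator g) (μ.map Subtype.val) ∧
        ∫ x, K.indicator g x ∂(μ.map Subtype.val) = ∫ x, g x ∂μ := by
    intro μ _ g hg
    have hm : Measurable (K.indicator g) := by
      classical
      rw [← piecewise_eq_indicator]
      exact hg.measurable_piecewise continuousOn_const hK.measurableSet
    obtain ⟨B, hB⟩ := hK.exists_bound_of_continuousOn hg
    refine ⟨Integrable.of_bound hm.aestronglyMeasurable (max B 0)
      (Eventually.of_forall fun x => ?_), ?_⟩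
    · by_cases hx : x ∈ K
      · rw [indicator_of_mem hx]
        exact (hB x hx).trans (le_max_left _ _)
      · rw [indicator_of_notMem hx, norm_zero]
        exact le_max_right _ _
    · rw [integral_map measurable_subtype_coe.aemeasurable hm.aestronglyMeasurable]
      refine integral_congr_ae (Eventually.of_forall fun x => ?_)
      simp
  refine ⟨(μ₁.map Subtype.val).toSignedMeasure - (μ₂.map Subtype.val).toSignedMeasure, ?_, ?_⟩
  · refine Measure.support_subset_of_isClosed hK.isClosed ?_
    rw [mem_ae_iff]
    have hle : ((μ₁.map Subtype.val).toSignedMeasure -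
        (μ₂.map Subtype.val).toSignedMeasure).variation ≤
        μ₁.map Subtype.val + μ₂.map Subtype.val := by
      refine VectorMeasure.variation_sub_le.trans_eq ?_
      rw [Measure.variation_toSignedMeasure, Measure.variation_toSignedMeasure]
    refine le_antisymm ((hle _).trans_eq ?_) bot_le
    rw [Measure.add_apply, hnull, hnull, add_zero]
  · intro f g hg hfg
    have hgK : ContinuousOn g K := hg.mono subset_union_right
    let h : C(K, ℝ) := ⟨K.domRestrict g, hgK.domRestrict⟩
    rw [← VectorMeasure.integral_indicator hK.measurableSet,
      integral_toSignedMeasure_sub (hint μ₁ g hgK).1 (hint μ₂ g hgK).1, (hint μ₁ g hgK).2,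
      (hint μ₂ g hgK).2, huniq f g h hg hfg fun x => rfl]
    exact hμ h

end BoundaryMeasure

/-! ### Cores and integrals of the induced measures -/

section FunctionalMeasures

lemma exists_indicator_Lp {α : Type*} [MeasurableSpace α] {μ : Measure α} {p : ℝ≥0∞}
    (f : Lp ℝ p μ) {A : Set α} (hA : MeasurableSet A) :
    ∃ q : Lp ℝ p μ, q =ᵐ[μ] A.indicator f :=
  ⟨((Lp.memLp f).indicator hA).toLp (A.indicator f), MemLp.coeFn_toLp _⟩

variable {n : ℕ} {U K V : Set (Euc n)}

lemma isBA_finAddOfFunctional (hVU : V ⊆ U) {ℓ : Linf V ℝ →ₗ[ℝ] ℝ} {C : ℝ} (hC : 0 ≤ C)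
    (hℓ : ∀ f, |ℓ f| ≤ C * ‖f‖) : IsBA U (finAddOfFunctional ℓ) := by
  refine ⟨⟨C, fun A _ => abs_finAddOfFunctional_le hC hℓ A⟩, fun A hA h => ?_⟩
  rw [finAddOfFunctional_apply, indicatorClass_eq_zero, map_zero]
  rw [Measure.restrict_apply hA]
  exact measure_mono_null (inter_subset_inter_right _ hVU) h

lemma core_subset {G : Type*} [NormedAddCommGroup G] {m : Set (Euc n) → G}
    (h : ∀ x ∉ K, ∃ O, IsOpen O ∧ x ∈ O ∧
      ∀ B, MeasurableSet B → B ⊆ O → m B = 0) : core U m ⊆ K := by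
  intro x hx
  by_contra hxK
  obtain ⟨O, hO, hxO, hB⟩ := h x hxK
  refine (hx O hO hxO).ne' (totalVar_eq_zero fun B hBm hBO => hB B hBm ?_)
  exact hBO.trans inter_subset_left

lemma finAddOfFunctional_eq_zero (ℓ : Linf V ℝ →ₗ[ℝ] ℝ) {B : Set (Euc n)} (hB : MeasurableSet B)
    (hBV : Disjoint B V) : finAddOfFunctional ℓ B = 0 := by
  rw [finAddOfFunctional_apply, indicatorClass_eq_zero, map_zero]
  rw [Measure.restrict_apply hB, hBV.inter_eq, measure_empty]

lemma core_finAddOfFunctional_subset_closure (ℓ : Linf V ℝ →ₗ[ℝ] ℝ) :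
    core U (finAddOfFunctional ℓ) ⊆ closure V :=
  core_subset fun _ hx =>
    ⟨_, isClosed_closure.isOpen_compl, hx, fun _ hBm hB => finAddOfFunctional_eq_zero ℓ hBm
      (disjoint_compl_left.mono hB subset_closure)⟩

lemma core_vecSet_subset_closure (ℓ : Fin n → Linf V ℝ →ₗ[ℝ] ℝ) :
    core U (vecSet fun j => finAddOfFunctional (ℓ j)) ⊆ closure V := by
  refine core_subset fun _ hx =>
    ⟨_, isClosed_closure.isOpen_compl, hx, fun B hBm hB => ?_⟩
  ext j
  exact finAddOfFunctional_eq_zero (ℓ j) hBm (disjoint_compl_left.mono hB subset_closure)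

lemma mem_nullNear_of_ae_eq_zero (hV : MeasurableSet V) {η : ℝ} (hη : 0 < η) {f : Linf V ℝ}
    (h : ∀ᵐ x ∂(volume.restrict V), x ∈ Metric.thickening η K → f x = 0) : f ∈ nullNear K V := by
  change Tendsto _ _ _
  refine tendsto_const_nhds.congr' ?_
  filter_upwards [Ioc_mem_nhdsGT hη] with r hr
  symm
  have h1 : f =ᵐ[volume.restrict (Metric.thickening r K ∩ V)] (0 : Euc n → ℝ) := by
    filter_upwards [ae_mono (restrict_le_of_subset inter_subset_right) h,
      ae_restrict_mem (Metric.isOpen_thickening.measurableSet.inter hV)]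
      with x h2 h3
    exact h2 (Metric.thickening_mono hr.2 K h3.1)
  rw [eLpNorm_congr_ae h1, eLpNorm_zero]

/-- A point off the closed set K has a neighbourhood disjoint from a thickening of K; indicators of
sets inside it belong to `nullNear`. -/
lemma core_finAddOfFunctional_subset (hK : IsClosed K) (hV : MeasurableSet V) {ℓ : Linf V ℝ →ₗ[ℝ] ℝ}
    (h0 : ∀ f ∈ nullNear K V, ℓ f = 0) : core U (finAddOfFunctional ℓ) ⊆ K := by
  refine core_subset fun x hx => ?_
  obtain ⟨η, hη, hd⟩ := (disjoint_singleton_left.2 hx).exists_thickenings isCompact_singleton hK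
  refine ⟨Metric.thickening η {x}, Metric.isOpen_thickening, Metric.self_subset_thickening hη _ rfl, fun B hBm hB => ?_⟩
  refine h0 _ (mem_nullNear_of_ae_eq_zero hV hη ?_)
  filter_upwards [coeFn_indicatorClass (μ := volume.restrict V) hBm] with y hy hyK
  rw [hy, indicator_of_notMem fun hyB => (hd.notMem_of_mem_left (hB hyB)) hyK]

lemma hasIntegralOn_finAddOfFunctional (hV : MeasurableSet V) {ℓ : Linf V ℝ →ₗ[ℝ] ℝ} {C : ℝ}
    (hC : 0 ≤ C) (hℓ : ∀ f, |ℓ f| ≤ C * ‖f‖) {A : Set (Euc n)} (hVA : V ⊆ A) {f : Linf V ℝ}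
    {φ : Euc n → ℝ} (hf : f =ᵐ[volume.restrict V] φ) :
    HasIntegralOn (finAddOfFunctional ℓ) A φ (ℓ f) := by
  refine hasIntegral_finAddOfFunctional hC hℓ f ?_
  filter_upwards [hf, ae_restrict_mem hV] with x hx hxV
  rw [hx, indicator_of_mem (hVA hxV)]

/-- If `ℓ` vanishes on `nullNear K V`, integrals of its measure can be restricted to any
neighbourhood of `K`. -/
lemma hasIntegralOn_inter_finAddOfFunctional (hK : IsCompact K) (hV : MeasurableSet V)
    (hVU : V ⊆ U) {ℓ : Linf V ℝ →ₗ[ℝ] ℝ} {C : ℝ} (hC : 0 ≤ C) (hℓ : ∀ f, |ℓ f| ≤ C * ‖f‖)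
    (h0 : ∀ f ∈ nullNear K V, ℓ f = 0) {O : Set (Euc n)} (hO : IsOpen O) (hKO : K ⊆ O)
    {f : Linf V ℝ} {φ : Euc n → ℝ} (hf : f =ᵐ[volume.restrict V] φ) :
    HasIntegralOn (finAddOfFunctional ℓ) (O ∩ U) φ (ℓ f) := by
  obtain ⟨q, hq⟩ : ∃ q : Linf V ℝ, q =ᵐ[volume.restrict V] O.indicator f :=
    exists_indicator_Lp f hO.measurableSet
  -- O contains a thickening of K, on which f and its cut-off to O coincide.
  have hqf : ℓ f = ℓ q := by
    obtain ⟨η, hη, hηO⟩ := hK.exists_thickening_subset_open hO hKO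
    rw [← sub_eq_zero, ← map_sub]
    refine h0 _ (mem_nullNear_of_ae_eq_zero hV hη ?_)
    filter_upwards [hq, Lp.coeFn_sub f q] with x h1 h2 hx
    rw [h2, Pi.sub_apply, h1, indicator_of_mem (hηO hx), sub_self]
  rw [hqf]
  refine hasIntegral_finAddOfFunctional hC hℓ q ?_
  filter_upwards [hq, hf, ae_restrict_mem hV] with x h1 h2 hxV
  rw [h1]
  by_cases hx : x ∈ O
  · rw [indicator_of_mem hx, indicator_of_mem (show x ∈ O ∩ U from ⟨hx, hVU hxV⟩), h2]
  · rw [indicator_of_notMem hx, indicator_of_notMem fun h : x ∈ O ∩ U => hx h.1]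

/-- The inclusion `f ↦ f eⱼ` of `L^∞(V)` into `L^∞(V, ℝⁿ)`. -/
def coordLinf (V : Set (Euc n)) (j : Fin n) : Linf V ℝ →ₗ[ℝ] Linf V (Euc n) :=
  (ContinuousLinearMap.toSpanSingleton ℝ (EuclideanSpace.single j (1 : ℝ))).compLpₗ ∞
    (volume.restrict V)

lemma coeFn_coordLinf (j : Fin n) (f : Linf V ℝ) :
    coordLinf V j f =ᵐ[volume.restrict V] fun x => f x • EuclideanSpace.single j (1 : ℝ) :=
  ContinuousLinearMap.coeFn_compLp _ _

lemma norm_coordLinf_le (j : Fin n) (f : Linf V ℝ) : ‖coordLinf V j f‖ ≤ ‖f‖ := by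
  refine norm_Linf_le (norm_nonneg f) ?_
  filter_upwards [coeFn_coordLinf j f, ae_norm_le_Linf f] with x h1 h2
  rw [h1, norm_smul, PiLp.norm_single, norm_one, mul_one]
  exact h2

lemma exists_sum_coordLinf (G : Linf V (Euc n)) : ∃ c : Fin n → Linf V ℝ,
    (∀ j, c j =ᵐ[volume.restrict V] fun x => G x j) ∧ G = ∑ j, coordLinf V j (c j) := by
  have hc : ∀ j : Fin n, (EuclideanSpace.proj j : Euc n →L[ℝ] ℝ).compLp G
      =ᵐ[volume.restrict V] fun x => G x j := fun j => ContinuousLinearMap.coeFn_compLp _ _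
  refine ⟨fun j => (EuclideanSpace.proj j : Euc n →L[ℝ] ℝ).compLp G, hc, ?_⟩
  rw [Lp.ext_iff]
  filter_upwards [eventually_all.2 hc, eventually_all.2 fun j => coeFn_coordLinf (V := V) j
    ((EuclideanSpace.proj j : Euc n →L[ℝ] ℝ).compLp G), Lp.coeFn_finsetSum Finset.univ fun j =>
    coordLinf V j ((EuclideanSpace.proj j : Euc n →L[ℝ] ℝ).compLp G)] with x h1 h2 h3
  rw [h3, Finset.sum_apply, Finset.sum_congr rfl fun j _ => (h2 j).trans (by rw [h1 j])]
  ext i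
  simp [Pi.single_apply]

lemma hasVecIntegralOn_finAddOfFunctional (hV : MeasurableSet V) {ℓ : Linf V (Euc n) →ₗ[ℝ] ℝ}
    {C : ℝ} (hC : 0 ≤ C) (hℓ : ∀ f j, |ℓ (coordLinf V j f)| ≤ C * ‖f‖) {G : Linf V (Euc n)}
    {g : Euc n → Euc n} (hG : G =ᵐ[volume.restrict V] g) :
    HasVecIntegralOn (fun j => finAddOfFunctional (ℓ.comp (coordLinf V j))) V g (ℓ G) := by
  obtain ⟨c, hc, hsum⟩ := exists_sum_coordLinf G
  refine ⟨fun j => ℓ (coordLinf V j (c j)), fun j => ?_, ?_⟩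
  · refine hasIntegralOn_finAddOfFunctional hV hC (ℓ := ℓ.comp (coordLinf V j))
      (fun f => hℓ f j) subset_rfl ?_
    filter_upwards [hc j, hG] with x h1 h2
    rw [h1, h2]
  · conv_lhs => rw [hsum, map_sum]

end FunctionalMeasures

/-! ### Splitting the functional into a part in φ and a part in Dφ -/

section BoundaryFunctional

/-- The seminorm p is the quotient norm pulled back to E. Inserting the second bound into the first
gives ‖ι w‖ + b w ≤ (D + 1)(p(ι w) + b w), hence the constant C(D + 1). -/
lemma exists_seminorm_of_quotient_bound {E W : Type*} [SeminormedAddCommGroup E]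
    [NormedSpace ℝ E] (N : Submodule ℝ E) {T b : W → ℝ} {ι : W → E} {C D : ℝ} (hC : 0 ≤ C)
    (hD : 0 ≤ D) (hT : ∀ w, |T w| ≤ C * (‖ι w‖ + b w))
    (hι : ∀ w, ‖ι w‖ ≤ D * (‖N.mkQ (ι w)‖ + b w)) :
    ∃ p : Seminorm ℝ E, (∀ f, p f ≤ ‖f‖) ∧ (∀ f ∈ N, p f = 0) ∧
      ∃ C', 0 ≤ C' ∧ ∀ w, |T w| ≤ C' * (p (ι w) + b w) := by
  refine ⟨(normSeminorm ℝ (E ⧸ N)).comp N.mkQ, fun f => Submodule.Quotient.norm_mk_le N f,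
    fun f hf => ?_, C * (D + 1), by positivity, fun w => ?_⟩
  · rw [Seminorm.comp_apply, Submodule.mkQ_apply, (Submodule.Quotient.mk_eq_zero _).2 hf,
      map_zero]
  · refine (hT w).trans ?_
    change _ ≤ C * (D + 1) * (‖N.mkQ (ι w)‖ + b w)
    rw [mul_assoc]
    refine mul_le_mul_of_nonneg_left ?_ hC
    linarith [hι w, norm_nonneg (N.mkQ (ι w))]

/-- Extend T to the product under the seminorm C(p₁ + p₂). Restricting the extension to each factor
leaves C p₁ or C p₂ alone. -/
lemma exists_functional_pair_of_bound {W E G : Type*} [AddCommGroup W] [Module ℝ W]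
    [AddCommGroup E] [Module ℝ E] [AddCommGroup G] [Module ℝ G] (T : W →ₗ[ℝ] ℝ) (ι₁ : W →ₗ[ℝ] E)
    (ι₂ : W →ₗ[ℝ] G) (p₁ : Seminorm ℝ E) (p₂ : Seminorm ℝ G) {C : ℝ} (hC : 0 ≤ C)
    (h : ∀ w, |T w| ≤ C * (p₁ (ι₁ w) + p₂ (ι₂ w))) :
    ∃ (Λ₁ : E →ₗ[ℝ] ℝ) (Λ₂ : G →ₗ[ℝ] ℝ), (∀ w, T w = Λ₁ (ι₁ w) + Λ₂ (ι₂ w)) ∧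
      (∀ f, |Λ₁ f| ≤ C * p₁ f) ∧ ∀ g, |Λ₂ g| ≤ C * p₂ g := by
  let p : Seminorm ℝ (E × G) := C.toNNReal •
    (p₁.comp (LinearMap.fst ℝ E G) + p₂.comp (LinearMap.snd ℝ E G))
  have hp : ∀ x, p x = C * (p₁ x.1 + p₂ x.2) := fun x => by
    change (C.toNNReal : ℝ) * (p₁ x.1 + p₂ x.2) = _
    rw [Real.coe_toNNReal C hC]
  obtain ⟨Λ, hΛ, hb⟩ := exists_functional_of_seminorm_bound T (ι₁.prod ι₂) p
    fun w => (h w).trans_eq (hp (ι₁ w, ι₂ w)).symm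
  refine ⟨Λ.comp (LinearMap.inl ℝ E G), Λ.comp (LinearMap.inr ℝ E G), fun w => ?_, fun f => ?_,
    fun g => ?_⟩
  · rw [LinearMap.comp_apply, LinearMap.comp_apply, ← map_add, ← hΛ w]
    simp
  · have := hb (f, 0)
    rwa [hp, map_zero, add_zero] at this
  · have := hb (0, g)
    rwa [hp, map_zero, zero_add] at this

variable {n : ℕ} {U Ω : Set (Euc n)} {F : Euc n → Euc n} {δ : ℝ}

lemma isCompact_frontier_of_subset (hUb : Bornology.IsBounded U) (hΩU : Ω ⊆ U) :
    IsCompact (frontier Ω) :=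
  (hUb.subset hΩU).isCompact_closure.of_isClosed_subset isClosed_frontier frontier_subset_closure

lemma subset_closure_thickening_inter {K : Set (Euc n)} (hδ : 0 < δ) (hKU : K ⊆ closure U) :
    K ⊆ closure (Metric.thickening δ K ∩ U) := fun x hx => by
  rw [mem_closure_iff]
  intro O hO hxO
  have := mem_closure_iff.1 (hKU hx) (O ∩ Metric.thickening δ K) (hO.inter Metric.isOpen_thickening)
    ⟨hxO, Metric.self_subset_thickening hδ K hx⟩
  rwa [inter_assoc] at this

lemma ae_norm_le_norm_restrictLinf {G : Type*} [NormedAddCommGroup G] [NormedSpace ℝ G]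
    {V : Set (Euc n)} (hVU : V ⊆ U) (f : Linf U G) :
    ∀ᵐ x ∂(volume.restrict V), ‖f x‖ ≤ ‖restrictLinf hVU f‖ := by
  filter_upwards [coeFn_restrictLinf hVU f, ae_norm_le_Linf (restrictLinf hVU f)] with x h1 h2
  rwa [h1] at h2

lemma exists_divFunctional_bound_restrict (hU : IsOpen U) (hUb : Bornology.IsBounded U)
    (hΩ : MeasurableSet Ω) (hΩU : Ω ⊆ U) (hF : MemDM1 U F) (hδ : 0 < δ)
    (hVU : Metric.thickening δ (frontier Ω) ∩ U ⊆ U) :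
    ∃ C, 0 ≤ C ∧ ∀ φ : W1inf U, |divFunctional hU hF Ω φ| ≤
      C * (‖restrictLinf hVU (funLinf U φ)‖ + ‖restrictLinf hVU (gradLinf U φ)‖) := by
  obtain ⟨C, hC, hT⟩ := exists_divFunctional_bound hU hUb hΩ hΩU hF hδ
  exact ⟨C, hC, fun φ => hT φ _ _ (norm_nonneg _) (norm_nonneg _)
    (ae_norm_le_norm_restrictLinf hVU (funLinf U φ))
    (ae_norm_le_norm_restrictLinf hVU (gradLinf U φ))⟩

lemma exists_restrict_bound_of_case (hU : IsOpen U) (hUb : Bornology.IsBounded U) (hΩU : Ω ⊆ U)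
    (hδ : 0 < δ) (hVU : Metric.thickening δ (frontier Ω) ∩ U ⊆ U)
    (hcase : CaseL U (frontier Ω) δ ∨ CaseC U (frontier Ω) δ) :
    ∃ D, 0 ≤ D ∧ ∀ φ : W1inf U, ‖restrictLinf hVU (funLinf U φ)‖ ≤
      D * (‖(nullNear (frontier Ω) (Metric.thickening δ (frontier Ω) ∩ U)).mkQ
        (restrictLinf hVU (funLinf U φ))‖ + ‖restrictLinf hVU (gradLinf U φ)‖) := by
  obtain ⟨D, hD, hb⟩ := hcase.elim CaseL.exists_bound
    (CaseC.exists_bound hU (isCompact_frontier_of_subset hUb hΩU)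
      (subset_closure_thickening_inter hδ (frontier_subset_closure.trans (closure_mono hΩU))))
  refine ⟨D, hD, fun φ => ?_⟩
  obtain ⟨χ, hχ1, hχ2⟩ := exists_restrict_W1inf hU.measurableSet hVU φ
  rw [← hχ1, ← hχ2]
  exact hb χ

/-- The theorem asks for a single pair of measures serving every case, so the dominating seminorm is
fixed beforehand: the quotient seminorm if (L) or (C) holds, the full norm otherwise. -/
lemma exists_seminorm_divFunctional_bound (hU : IsOpen U) (hUb : Bornology.IsBounded U)
    (hΩ : MeasurableSet Ω) (hΩU : Ω ⊆ U) (hF : MemDM1 U F) (hδ : 0 < δ)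
    (hVU : Metric.thickening δ (frontier Ω) ∩ U ⊆ U) :
    ∃ p : Seminorm ℝ (Linf (Metric.thickening δ (frontier Ω) ∩ U) ℝ), (∀ f, p f ≤ ‖f‖) ∧
      (CaseL U (frontier Ω) δ ∨ CaseC U (frontier Ω) δ →
        ∀ f ∈ nullNear (frontier Ω) (Metric.thickening δ (frontier Ω) ∩ U), p f = 0) ∧
      ∃ C, 0 ≤ C ∧ ∀ φ : W1inf U, |divFunctional hU hF Ω φ| ≤
        C * (p (restrictLinf hVU (funLinf U φ)) + ‖restrictLinf hVU (gradLinf U φ)‖) := by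
  obtain ⟨C, hC, hT⟩ := exists_divFunctional_bound_restrict hU hUb hΩ hΩU hF hδ hVU
  by_cases hcase : CaseL U (frontier Ω) δ ∨ CaseC U (frontier Ω) δ
  · obtain ⟨D, hD, hDb⟩ := exists_restrict_bound_of_case hU hUb hΩU hδ hVU hcase
    obtain ⟨p, h1, h2, h3⟩ := exists_seminorm_of_quotient_bound _ hC hD hT hDb
    exact ⟨p, h1, fun _ => h2, h3⟩
  · exact ⟨normSeminorm ℝ _, fun f => le_rfl, fun h => absurd h hcase, C, hC, hT⟩

/-- The functional `φ ↦ div(φF)(Ω)` is a sum of bounded functionals of `φ` and `Dφ` near the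
boundary of `Ω`. -/
theorem exists_boundary_functionals (hU : IsOpen U) (hUb : Bornology.IsBounded U)
    (hΩ : MeasurableSet Ω) (hΩU : Ω ⊆ U) (hF : MemDM1 U F) (hδ : 0 < δ)
    (hVU : Metric.thickening δ (frontier Ω) ∩ U ⊆ U) :
    ∃ (Λ₁ : Linf (Metric.thickening δ (frontier Ω) ∩ U) ℝ →ₗ[ℝ] ℝ)
      (Λ₂ : Linf (Metric.thickening δ (frontier Ω) ∩ U) (Euc n) →ₗ[ℝ] ℝ) (C : ℝ), 0 ≤ C ∧
      (∀ f, |Λ₁ f| ≤ C * ‖f‖) ∧ (∀ G, |Λ₂ G| ≤ C * ‖G‖) ∧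
      (∀ φ : W1inf U, divMeasure U (fun x => funRep φ x • F x) Ω =
        Λ₁ (restrictLinf hVU (funLinf U φ)) + Λ₂ (restrictLinf hVU (gradLinf U φ))) ∧
      (CaseL U (frontier Ω) δ ∨ CaseC U (frontier Ω) δ →
        ∀ f ∈ nullNear (frontier Ω) (Metric.thickening δ (frontier Ω) ∩ U), Λ₁ f = 0) := by
  obtain ⟨p, hp1, hp2, C, hC, hb⟩ :=
    exists_seminorm_divFunctional_bound hU hUb hΩ hΩU hF hδ hVU
  obtain ⟨Λ₁, Λ₂, h1, h2, h3⟩ := exists_functional_pair_of_bound (divFunctional hU hF Ω)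
    ((restrictLinf hVU).comp (funLinf U)) ((restrictLinf hVU).comp (gradLinf U)) p
    (normSeminorm ℝ _) hC hb
  refine ⟨Λ₁, Λ₂, C, hC, fun f => (h2 f).trans (mul_le_mul_of_nonneg_left (hp1 f) hC), h3, h1,
    fun hcase f hf => ?_⟩
  have := h2 f
  rwa [hp2 hcase f hf, mul_zero, abs_nonpos_iff] at this

end BoundaryFunctional

/-! ### Continuous extensions and the main theorem -/

section Main

variable {n : ℕ}

lemma exists_Linf_of_continuousOn {V S : Set (Euc n)} (hV : MeasurableSet V) (hS : IsCompact S)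
    (hVS : V ⊆ S) {ψ : Euc n → ℝ} (hψ : ContinuousOn ψ S) :
    ∃ f : Linf V ℝ, f =ᵐ[volume.restrict V] ψ := by
  obtain ⟨B, hB⟩ := hS.exists_bound_of_continuousOn hψ
  have h : MemLp ψ ∞ (volume.restrict V) :=
    memLp_top_of_bound ((hψ.mono hVS).aestronglyMeasurable hV) B <| by
      filter_upwards [ae_restrict_mem hV] with x hx using hB x (hVS hx)
  exact ⟨h.toLp ψ, h.coeFn_toLp⟩

lemma CaseC.exists_isContExt {U K : Set (Euc n)} {δ : ℝ} (h : CaseC U K δ) (hU : IsOpen U)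
    (hVU : Metric.thickening δ K ∩ U ⊆ U) (φ : W1inf U) :
    ∃ g, IsContExt (Metric.thickening δ K ∩ U) K (funRep φ) g ∧
      restrictLinf hVU (funLinf U φ) =ᵐ[volume.restrict (Metric.thickening δ K ∩ U)] g := by
  obtain ⟨χ, hχ, -⟩ := exists_restrict_W1inf hU.measurableSet hVU φ
  obtain ⟨ι₀, hι, -⟩ := h
  obtain ⟨g, ⟨hg, hgχ⟩, -⟩ := hι χ
  have h1 : g =ᵐ[volume.restrict (Metric.thickening δ K ∩ U)]
      restrictLinf hVU (funLinf U φ) := by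
    rw [← hχ]
    exact hgχ
  exact ⟨g, ⟨hg, h1.trans (coeFn_restrictLinf hVU (funLinf U φ))⟩, h1.symm⟩

end Main

end

theorem mainTheorem1 (n : ℕ) (U Ω : Set (Euc n)) (hU : IsOpen U) (hUb : Bornology.IsBounded U)
    (hΩ : MeasurableSet Ω) (hΩU : Ω ⊆ U) (F : Euc n → Euc n) (hF : MemDM1 U F)
    (δ : ℝ) (hδ : 0 < δ) :
    ∃ (lam : FinAddMeasure (Euc n)) (mu : Fin n → FinAddMeasure (Euc n)),
      IsBA U lam ∧ (∀ j, IsBA U (mu j)) ∧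
      core U lam ⊆ closure (Metric.thickening δ (frontier Ω) ∩ U) ∧
      core U (vecSet mu) ⊆ closure (Metric.thickening δ (frontier Ω) ∩ U) ∧
      (∀ φ : W1inf U, MemDM1 U (fun x => funRep φ x • F x) ∧
        ∃ I J : ℝ, HasIntegralOn lam (Metric.thickening δ (frontier Ω) ∩ U) (funRep φ) I ∧
          HasVecIntegralOn mu (Metric.thickening δ (frontier Ω) ∩ U) (gradRep φ) J ∧
          divMeasure U (fun x => funRep φ x • F x) Ω = I + J) ∧
      (CaseL U (frontier Ω) δ →
        core U lam ⊆ frontier Ω ∧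
        ∀ (φ : W1inf U) (O : Set (Euc n)), IsOpen O → frontier Ω ⊆ O →
          ∃ I J : ℝ, HasIntegralOn lam (O ∩ U) (funRep φ) I ∧
            HasVecIntegralOn mu (Metric.thickening δ (frontier Ω) ∩ U) (gradRep φ) J ∧
            divMeasure U (fun x => funRep φ x • F x) Ω = I + J) ∧
      (CaseC U (frontier Ω) δ →
        core U lam ⊆ frontier Ω ∧
        ∃ σ : SignedMeasure (Euc n), σ.variation.support ⊆ frontier Ω ∧
          (∀ ψ : Euc n → ℝ, ContinuousOn ψ (closure U) →
            HasIntegralOn lam U ψ (∫ᵛ x in frontier Ω, ψ x ∂•σ)) ∧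
          ∀ φ : W1inf U, ∃ g : Euc n → ℝ,
            IsContExt (Metric.thickening δ (frontier Ω) ∩ U) (frontier Ω) (funRep φ) g ∧
            ∃ J : ℝ, HasVecIntegralOn mu (Metric.thickening δ (frontier Ω) ∩ U) (gradRep φ) J ∧
              divMeasure U (fun x => funRep φ x • F x) Ω =
                (∫ᵛ x in frontier Ω, g x ∂•σ) + J) := by
  have hVU : Metric.thickening δ (frontier Ω) ∩ U ⊆ U := inter_subset_right
  have hV : MeasurableSet (Metric.thickening δ (frontier Ω) ∩ U) :=
    (Metric.isOpen_thickening.inter hU).measurableSet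
  have hK := isCompact_frontier_of_subset hUb hΩU
  obtain ⟨Λ₁, Λ₂, C, hC, hΛ₁, hΛ₂, hdiv, h0⟩ :=
    exists_boundary_functionals hU hUb hΩ hΩU hF hδ hVU
  have hΛ₂c : ∀ f j, |Λ₂ (coordLinf _ j f)| ≤ C * ‖f‖ := fun f j =>
    (hΛ₂ _).trans (mul_le_mul_of_nonneg_left (norm_coordLinf_le j f) hC)
  have hf : ∀ φ : W1inf U, restrictLinf hVU (funLinf U φ) =ᵐ[volume.restrict _] funRep φ :=
    fun φ => coeFn_restrictLinf hVU (funLinf U φ)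
  have hJ : ∀ φ : W1inf U, HasVecIntegralOn
      (fun j => finAddOfFunctional (Λ₂.comp (coordLinf _ j))) _ (gradRep φ)
      (Λ₂ (restrictLinf hVU (gradLinf U φ))) := fun φ =>
    hasVecIntegralOn_finAddOfFunctional hV hC hΛ₂c (coeFn_restrictLinf hVU (gradLinf U φ))
  refine ⟨finAddOfFunctional Λ₁, fun j => finAddOfFunctional (Λ₂.comp (coordLinf _ j)),
    isBA_finAddOfFunctional hVU hC hΛ₁,
    fun j => isBA_finAddOfFunctional hVU hC fun f => hΛ₂c f j,
    core_finAddOfFunctional_subset_closure Λ₁, core_vecSet_subset_closure _,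
    fun φ => ⟨memDM1_smul hU hF φ, _, _, hasIntegralOn_finAddOfFunctional hV hC hΛ₁ subset_rfl
      (hf φ), hJ φ, hdiv φ⟩, fun hL => ?_, fun hcC => ?_⟩
  · exact ⟨core_finAddOfFunctional_subset isClosed_frontier hV (h0 (Or.inl hL)),
      fun φ O hO hKO => ⟨_, _, hasIntegralOn_inter_finAddOfFunctional hK hV hVU hC hΛ₁
        (h0 (Or.inl hL)) hO hKO (hf φ), hJ φ, hdiv φ⟩⟩
  · obtain ⟨σ, hσ, hint⟩ := exists_signedMeasure_of_functional hK hV hC hΛ₁ (h0 (Or.inr hcC))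
    refine ⟨core_finAddOfFunctional_subset isClosed_frontier hV (h0 (Or.inr hcC)), σ, hσ,
      fun ψ hψ => ?_, fun φ => ?_⟩
    · obtain ⟨f, hfψ⟩ := exists_Linf_of_continuousOn hV hUb.isCompact_closure
        (hVU.trans subset_closure) hψ
      rw [← hint f ψ (hψ.mono (union_subset (hVU.trans subset_closure)
        (frontier_subset_closure.trans (closure_mono hΩU)))) hfψ]
      -- The measure is carried by V, so the integral over all of U only sees ψ on V.
      exact hasIntegralOn_finAddOfFunctional hV hC hΛ₁ hVU hfψ
    · obtain ⟨g, hg, hgφ⟩ := hcC.exists_isContExt hU hVU φ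
      refine ⟨g, hg, _, hJ φ, ?_⟩
      -- The boundary integral of the extension g is Λ₁ of the restriction of φ to V, which is the
      -- first term of the basic identity.
      rw [← hint _ g hg.1 hgφ]
      exact hdiv φ
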